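/- Let $k$ be a field and $H$ a Hopf algebra over $k$ with bijective antipode $S$. Let $G=\mathrm{Aut}_{Hopf}(H)\times \mathrm{Aut}_{Hopf}(H)$, a group with product $(\alpha,\beta)*(\gamma,\delta)=(\alpha\gamma,\ \delta\gamma^{-1}\beta\gamma)$. For $(\alpha,\beta)\in G$ let ${}_H\mathcal{YD}^H(\alpha,\beta)$ be the category of vector spaces $M$ that are left $H$-modules and right $H$-comodules ($m\mapsto m_{(0)}\otimes m_{(1)}$) with $$(h\cdot m)_{(0)}\otimes (h\cdot m)_{(1)}=h_2\cdot m_{(0)}\otimes \beta(h_3)\,m_{(1)}\,\alpha(S^{-1}(h_1))\qquad (h\in H,\ m\in M),$$ with the $H$-linear $H$-colinear maps as morphisms, and let $\mathcal{YD}(H)$ be the disjoint union of the categories ${}_H\mathcal{YD}^H(\alpha,\beta)$, $(\alpha,\beta)\in G$. A T-category over $G$ is a monoidal category $\mathcal T$ that is the disjoint union of categories $\mathcal T_g$, $g\in G$, with unit in $\mathcal T_1$ and $\mathcal T_g\otimes\mathcal T_h\subseteq\mathcal T_{gh}$, together with a group homomorphism $\varphi$ from $G$ to the group of invertible strict monoidal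 endofunctors of $\mathcal T$ such that $\varphi_g(\mathcal T_h)\subseteq\mathcal T_{ghg^{-1}}$. For $X\in\mathcal T_g$ write ${}^XY=\varphi_g(Y)$. It is braided if it is equipped with isomorphisms $c_{X,Y}:X\otimes Y\to{}^XY\otimes X$ such that (suppressing associativity constraints) $({}^Xf'\otimes f)\circ c_{X,Y}=c_{X',Y'}\circ(f\otimes f')$ for all $f:X\to X'$, $f':Y\to Y'$, where ${}^Xf'=\varphi_g(f')$; $c_{X\otimes Y,Z}=(c_{X,{}^YZ}\otimes \mathrm{id}_Y)\circ(\mathrm{id}_X\otimes c_{Y,Z})$; $c_{X,Y\otimes Z}=(\mathrm{id}_{{}^XY}\otimes c_{X,Z})\circ(c_{X,Y}\otimes\mathrm{id}_Z)$; and $\varphi_g(c_{X,Y})=c_{\varphi_g(X),\varphi_g(Y)}$. Theorem. $\mathcal{YD}(H)$ is a braided T-category over $G$, with components ${}_H\mathcal{YD}^H(\alpha,\beta)$ and with the following data, for $M\in{}_H\mathcal{YD}^H(\alpha,\beta)$ and $N\in{}_H\mathcal{YD}^H(\gamma,\delta)$: - the tensor product of $M$ and $N$ is the vector space $M\otimes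 N$, as an object of ${}_H\mathcal{YD}^H((\alpha,\beta)*(\gamma,\delta))$, with $h\cdot(m\otimes n)=\gamma(h_1)\cdot m\otimes\gamma^{-1}\beta\gamma(h_2)\cdot n$ and $m\otimes n\mapsto (m_{(0)}\otimes n_{(0)})\otimes n_{(1)}m_{(1)}$; the unit is $k$ with $h\cdot 1=\varepsilon(h)$, $1\mapsto 1\otimes 1$, in ${}_H\mathcal{YD}^H(\mathrm{id},\mathrm{id})$; the tensor product of morphisms and the associativity and unit constraints are those of vector spaces; - $\varphi_{(\alpha,\beta)}(N)={}^{(\alpha,\beta)}N$ is the vector space $N$, as an object of ${}_H\mathcal{YD}^H((\alpha,\beta)*(\gamma,\delta)*(\alpha,\beta)^{-1})$, with action $h\rightharpoonup n=\gamma^{-1}\beta\gamma\alpha^{-1}(h)\cdot n$ and coaction $n\mapsto n_{(0)}\otimes\alpha\beta^{-1}(n_{(1)})$, and $\varphi_{(\alpha,\beta)}$ is the identity on morphisms; - the braiding is $c_{M,N}(m\otimes n)=n_{(0)}\otimes\beta^{-1}(n_{(1)})\cdot m$. -/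

import Mathlib

open CategoryTheory MonoidalCategory
open scoped TensorProduct

universe u v w x

noncomputable section

/-! ### Strict tensor functors, T-categories, braided T-categories -/

namespace TCat

/-- A functor between monoidal categories is a strict tensor functor if it carries a (strong)
monoidal structure all of whose structure morphisms are identities (up to the equalities of objects
that they witness). -/
def IsStrictTensor {C : Type u} {D : Type v} [Category.{w} C] [Category.{x} D]
    [MonoidalCategory C] [MonoidalCategory D] (F : C ⥤ D) : Prop :=
  ∃ _ : F.Monoidal,
    (∃ h : 𝟙_ D = F.obj (𝟙_ C), Functor.LaxMonoidal.ε F = eqToHom h) ∧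
    ∀ X Y : C, ∃ h : F.obj X ⊗ F.obj Y = F.obj (X ⊗ Y),
      Functor.LaxMonoidal.μ F X Y = eqToHom h

theorem IsStrictTensor.obj_tensor {C : Type u} {D : Type v} [Category.{w} C] [Category.{x} D]
    [MonoidalCategory C] [MonoidalCategory D] {F : C ⥤ D} (hF : IsStrictTensor F) (X Y : C) :
    F.obj (X ⊗ Y) = F.obj X ⊗ F.obj Y := by
  obtain ⟨_, -, h⟩ := hF
  exact (h X Y).choose.symm

/-- Two objects of a disjoint union of categories that are joined by a morphism lie in the same
component. -/
theorem deg_eq_of_hom {G : Type u} {C : G → Type v} [∀ g, Category.{w} (C g)]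
    {X Y : Σ g, C g} (f : X ⟶ Y) : X.1 = Y.1 := by
  rcases X with ⟨i, X⟩
  rcases Y with ⟨j, Y⟩
  exact match f with
    | Sigma.SigmaHom.mk _ => rfl

/-- A T-category (crossed group-category) over the group `G` with components `C g`, on a tensor
category structure of the disjoint union `Σ g, C g`: the tensor product is graded, and `conj` is
a homomorphism from `G` to the group of invertible strict tensor endofunctors
(invertibility of `conj g` follows from `conj_one` and `conj_mul`) which acts on the components
by conjugation. -/
structure TCategory (G : Type u) [Group G] (C : G → Type v) [∀ g, Category.{w} (C g)]
    [MonoidalCategory (Σ g, C g)] where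
  deg_unit : (𝟙_ (Σ g, C g)).1 = 1
  deg_tensor : ∀ X Y : Σ g, C g, (X ⊗ Y).1 = X.1 * Y.1
  conj : G → ((Σ g, C g) ⥤ (Σ g, C g))
  conj_one : conj 1 = 𝟭 _
  conj_mul : ∀ g h, conj (g * h) = conj h ⋙ conj g
  conj_strict : ∀ g, IsStrictTensor (conj g)
  deg_conj : ∀ g X, ((conj g).obj X).1 = g * X.1 * g⁻¹

namespace TCategory

variable {G : Type u} [Group G] {C : G → Type v} [∀ g, Category.{w} (C g)]
  [MonoidalCategory (Σ g, C g)] (T : TCategory G C)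

/-- The object `ˣY`: the conjugate of `Y` by the degree of `X`. -/
def act (X Y : Σ g, C g) : Σ g, C g := (T.conj X.1).obj Y

theorem act_congr {X X' : Σ g, C g} (h : X.1 = X'.1) (Y : Σ g, C g) :
    T.act X Y = T.act X' Y := by
  simp only [act, h]

theorem act_act (X Y Z : Σ g, C g) : T.act X (T.act Y Z) = T.act (X ⊗ Y) Z := by
  simp only [act, T.deg_tensor, T.conj_mul, Functor.comp_obj]

theorem act_tensor (X Y Z : Σ g, C g) : T.act X (Y ⊗ Z) = T.act X Y ⊗ T.act X Z :=
  (T.conj_strict X.1).obj_tensor Y Z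

theorem conj_act (g : G) (X Y : Σ g, C g) :
    (T.conj g).obj (T.act X Y) = T.act ((T.conj g).obj X) ((T.conj g).obj Y) := by
  have h : T.conj X.1 ⋙ T.conj g = T.conj g ⋙ T.conj (g * X.1 * g⁻¹) := by
    rw [← T.conj_mul, ← T.conj_mul]
    simp
  simp only [act, T.deg_conj]
  exact congrArg (fun F => F.obj Y) h

end TCategory

/-- A braided T-category: a T-category with isomorphisms `c X Y : X ⊗ Y ≅ ˣY ⊗ X`, natural,
satisfying the two hexagon identities, and preserved by the conjugation functors. -/
structure BraidedTCategory (G : Type u) [Group G] (C : G → Type v) [∀ g, Category.{w} (C g)]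
    [MonoidalCategory (Σ g, C g)] extends TCategory G C where
  c : ∀ X Y : Σ g, C g, X ⊗ Y ≅ toTCategory.act X Y ⊗ X
  naturality : ∀ {X X' Y Y' : Σ g, C g} (f : X ⟶ X') (f' : Y ⟶ Y'),
    (f ⊗ₘ f') ≫ (c X' Y').hom =
      (c X Y).hom ≫ (((conj X.1).map f' ≫
        eqToHom (toTCategory.act_congr (deg_eq_of_hom f) Y')) ⊗ₘ f)
  hexagon_left : ∀ X Y Z : Σ g, C g,
    (c (X ⊗ Y) Z).hom =
      (α_ X Y Z).hom ≫ (X ◁ (c Y Z).hom) ≫ (α_ X (toTCategory.act Y Z) Y).inv ≫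
      ((c X (toTCategory.act Y Z)).hom ▷ Y) ≫
      (α_ (toTCategory.act X (toTCategory.act Y Z)) X Y).hom ≫
      (eqToHom (toTCategory.act_act X Y Z) ▷ (X ⊗ Y))
  hexagon_right : ∀ X Y Z : Σ g, C g,
    (c X (Y ⊗ Z)).hom =
      (α_ X Y Z).inv ≫ ((c X Y).hom ▷ Z) ≫ (α_ (toTCategory.act X Y) X Z).hom ≫
      (toTCategory.act X Y ◁ (c X Z).hom) ≫
      (α_ (toTCategory.act X Y) (toTCategory.act X Z) X).inv ≫
      (eqToHom (toTCategory.act_tensor X Y Z).symm ▷ X)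
  conj_c : ∀ (g : G) (X Y : Σ g, C g),
    (conj g).map (c X Y).hom =
      eqToHom ((conj_strict g).obj_tensor X Y) ≫
      (c ((conj g).obj X) ((conj g).obj Y)).hom ≫
      eqToHom (((conj_strict g).obj_tensor (toTCategory.act X Y) X).trans
        (congrArg (fun Z => Z ⊗ (conj g).obj X) (toTCategory.conj_act g X Y))).symm

end TCat

/-! ### Hopf algebras with bijective antipode and the group of pairs of automorphisms -/

namespace YD

/-- The antipode of the Hopf algebra `H` is bijective. -/
class BijectiveAntipode (k H : Type u) [Field k] [Ring H] [HopfAlgebra k H] : Prop where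
  bijective : Function.Bijective (HopfAlgebra.antipode k : H →ₗ[k] H)

/-- The inverse `S⁻¹` of the antipode. -/
def antipodeInv (k H : Type u) [Field k] [Ring H] [HopfAlgebra k H] [BijectiveAntipode k H] :
    H →ₗ[k] H :=
  (LinearEquiv.ofBijective (HopfAlgebra.antipode k : H →ₗ[k] H)
    BijectiveAntipode.bijective).symm.toLinearMap

/-- Pairs `(α, β)` of Hopf algebra automorphisms of `H` (a bialgebra automorphism commutes with
the antipode automatically). -/
@[ext]
structure AutPair (k H : Type u) [Field k] [Ring H] [HopfAlgebra k H] where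
  α : H ≃ₐc[k] H
  β : H ≃ₐc[k] H

namespace AutPair

variable {k H : Type u} [Field k] [Ring H] [HopfAlgebra k H]

instance : One (AutPair k H) := ⟨⟨BialgEquiv.refl k H, BialgEquiv.refl k H⟩⟩

/-- `(α, β) * (γ, δ) = (α γ, δ γ⁻¹ β γ)`; note that `e.trans f` is the composite `f ∘ e`. -/
instance : Mul (AutPair k H) :=
  ⟨fun p q => ⟨q.α.trans p.α, ((q.α.trans p.β).trans q.α.symm).trans q.β⟩⟩

/-- `(α, β)⁻¹ = (α⁻¹, α β⁻¹ α⁻¹)`. -/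
instance : Inv (AutPair k H) := ⟨fun p => ⟨p.α.symm, (p.α.symm.trans p.β.symm).trans p.α⟩⟩

theorem mul_α_apply (p q : AutPair k H) (h : H) : (p * q).α h = p.α (q.α h) := rfl

theorem mul_β_apply (p q : AutPair k H) (h : H) :
    (p * q).β h = q.β (q.α.symm (p.β (q.α h))) := rfl

instance : Group (AutPair k H) where
  mul_assoc p q r := by
    ext h
    · rfl
    · change r.β (r.α.symm (q.β (q.α.symm (p.β (q.α (r.α h)))))) =
        r.β (r.α.symm (q.β (r.α (r.α.symm (q.α.symm (p.β (q.α (r.α h))))))))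
      simp
  one_mul p := by
    ext h
    · rfl
    · exact congrArg p.β (p.α.symm_apply_apply h)
  mul_one p := by
    ext h
    · rfl
    · rfl
  inv_mul_cancel p := by
    ext h
    · exact p.α.symm_apply_apply h
    · change p.β (p.α.symm (p.α (p.β.symm (p.α.symm (p.α h))))) = h
      simp

/-- The automorphism `γ⁻¹ β γ`, for `p = (α, β)` and `q = (γ, δ)`. -/
def twist (p q : AutPair k H) : H ≃ₐc[k] H := (q.α.trans p.β).trans q.α.symm

end AutPair

/-! ### Yetter-Drinfeld modules -/

/-- A vector space `V` with a left `H`-module structure `h · v = ρ h v`, given by an algebra map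
`ρ : H → End V`, and a linear map `δ : V → V ⊗ H`, `v ↦ v₍₀₎ ⊗ v₍₁₎`. -/
structure ModData (k H : Type u) [Field k] [Ring H] [HopfAlgebra k H] where
  V : Type u
  [addCommGroup : AddCommGroup V]
  [module : Module k V]
  ρ : H →ₐ[k] Module.End k V
  δ : V →ₗ[k] V ⊗[k] H

attribute [instance] ModData.addCommGroup ModData.module

variable {k H : Type u} [Field k] [Ring H] [HopfAlgebra k H]

/-- `a ↦ c ↦ (x ↦ β(c) x α(S⁻¹(a)))`, where `p = (α, β)`. -/
def sandwich [BijectiveAntipode k H] (p : AutPair k H) : H →ₗ[k] H →ₗ[k] Module.End k H :=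
  LinearMap.mk₂ k
    (fun a c => LinearMap.mulLeft k (p.β c) ∘ₗ LinearMap.mulRight k (p.α (antipodeInv k H a)))
    (fun a a' c => by ext; simp [mul_add])
    (fun r a c => by ext; simp)
    (fun a c c' => by ext; simp [add_mul])
    (fun r a c => by ext; simp)

/-- The map sending `a ⊗ (b ⊗ c)` to the endomorphism
`v ⊗ x ↦ b · v ⊗ β(c) x α(S⁻¹(a))` of `V ⊗ H`, where `p = (α, β)`. -/
def ydTwist [BijectiveAntipode k H] (p : AutPair k H) (M : ModData k H) :
    H ⊗[k] (H ⊗[k] H) →ₗ[k] Module.End k (M.V ⊗[k] H) :=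
  TensorProduct.homTensorHomMap (RingHom.id k) M.V H M.V H ∘ₗ
    TensorProduct.map M.ρ.toLinearMap (TensorProduct.lift (sandwich p)) ∘ₗ
    (TensorProduct.leftComm k H H H).toLinearMap

theorem ydTwist_tmul [BijectiveAntipode k H] (p : AutPair k H) (M : ModData k H)
    (a b c x : H) (v : M.V) :
    ydTwist p M (a ⊗ₜ (b ⊗ₜ c)) (v ⊗ₜ x) =
      M.ρ b v ⊗ₜ (p.β c * x * p.α (antipodeInv k H a)) := by
  simp [ydTwist, sandwich, mul_assoc]

/-- An `(α, β)`-Yetter-Drinfeld module: a left `H`-module and right `H`-comodule such that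
`(h · v)₍₀₎ ⊗ (h · v)₍₁₎ = h₂ · v₍₀₎ ⊗ β(h₃) v₍₁₎ α(S⁻¹(h₁))`. -/
structure YDMod (k H : Type u) [Field k] [Ring H] [HopfAlgebra k H] [BijectiveAntipode k H]
    (p : AutPair k H) extends ModData k H where
  coassoc : (Coalgebra.comul (R := k) (A := H)).lTensor V ∘ₗ δ =
    (TensorProduct.assoc k V H H).toLinearMap ∘ₗ δ.rTensor H ∘ₗ δ
  counit : (TensorProduct.rid k V).toLinearMap ∘ₗ
    (Coalgebra.counit (R := k) (A := H)).lTensor V ∘ₗ δ = LinearMap.id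
  compat : ∀ (h : H) (v : V), δ (ρ h v) =
    ydTwist p toModData
      ((Coalgebra.comul (R := k) (A := H)).lTensor H (Coalgebra.comul (R := k) h)) (δ v)

/-- Morphisms are the `H`-linear `H`-colinear maps. -/
@[ext]
structure YDMod.Hom [BijectiveAntipode k H] {p : AutPair k H} (M N : YDMod k H p) where
  lin : M.V →ₗ[k] N.V
  linear : ∀ (h : H) (v : M.V), lin (M.ρ h v) = N.ρ h (lin v)
  colinear : lin.rTensor H ∘ₗ M.δ = N.δ ∘ₗ lin

/-- The category `_H YD^H(α, β)`. -/
instance [BijectiveAntipode k H] (p : AutPair k H) : Category (YDMod k H p) where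
  Hom M N := YDMod.Hom M N
  id M := ⟨LinearMap.id, fun _ _ => rfl, by simp⟩
  comp f g := ⟨g.lin ∘ₗ f.lin, fun h v => by simp [f.linear, g.linear], by
    rw [LinearMap.rTensor_comp, LinearMap.comp_assoc, f.colinear, ← LinearMap.comp_assoc,
      g.colinear, LinearMap.comp_assoc]⟩

/-- The forgetful functor from `YD(H)`, the disjoint union of all the categories
`_H YD^H(α, β)`, to vector spaces. -/
def forget (k H : Type u) [Field k] [Ring H] [HopfAlgebra k H] [BijectiveAntipode k H] :
    (Σ p : AutPair k H, YDMod k H p) ⥤ ModuleCat.{u} k :=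
  Sigma.desc fun _ =>
    { obj := fun M => ModuleCat.of k M.V
      map := fun f => ModuleCat.ofHom f.lin }

/-! ### The data of the braided T-category -/

/-- The ground field with the trivial structures `h · 1 = ε(h)`, `1 ↦ 1 ⊗ 1`. -/
def ModData.unit (k H : Type u) [Field k] [Ring H] [HopfAlgebra k H] : ModData k H where
  V := k
  ρ := (Algebra.ofId k (Module.End k k)).comp (Bialgebra.counitAlgHom k H)
  δ := (TensorProduct.mk k k H).flip 1

/-- `h · (m ⊗ n) = γ(h₁) · m ⊗ γ⁻¹βγ(h₂) · n`, for `p = (α, β)` and `q = (γ, δ)`. -/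
def tensorAct (p q : AutPair k H) (M N : ModData k H) :
    H →ₐ[k] Module.End k (M.V ⊗[k] N.V) :=
  (Module.endTensorEndAlgHom (R := k) (S := k) (A := k) (M := M.V) (N := N.V)).comp
    ((Algebra.TensorProduct.map (M.ρ.comp (q.α : H →ₐ[k] H))
      (N.ρ.comp (p.twist q : H →ₐ[k] H))).comp (Bialgebra.comulAlgHom k H))

/-- `m ⊗ n ↦ (m₍₀₎ ⊗ n₍₀₎) ⊗ n₍₁₎ m₍₁₎`. -/
def tensorCoact (M N : ModData k H) : M.V ⊗[k] N.V →ₗ[k] (M.V ⊗[k] N.V) ⊗[k] H :=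
  (LinearMap.mul' k H ∘ₗ (TensorProduct.comm k H H).toLinearMap).lTensor (M.V ⊗[k] N.V) ∘ₗ
    (TensorProduct.tensorTensorTensorComm k M.V H N.V H).toLinearMap ∘ₗ TensorProduct.map M.δ N.δ

/-- The twisted tensor product of `M`, of degree `p`, and `N`, of degree `q`. -/
def ModData.tensor (p q : AutPair k H) (M N : ModData k H) : ModData k H where
  V := M.V ⊗[k] N.V
  ρ := tensorAct p q M N
  δ := tensorCoact M N

/-- `h ⇀ n = γ⁻¹βγα⁻¹(h) · n`, for `p = (α, β)` and `q = (γ, δ)`. -/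
def conjAct (p q : AutPair k H) (N : ModData k H) : H →ₐ[k] Module.End k N.V :=
  N.ρ.comp ((p.α.symm.trans (p.twist q) : H ≃ₐc[k] H) : H →ₐ[k] H)

/-- `n ↦ n₍₀₎ ⊗ αβ⁻¹(n₍₁₎)`, for `p = (α, β)`. -/
def conjCoact (p : AutPair k H) (N : ModData k H) : N.V →ₗ[k] N.V ⊗[k] H :=
  ((p.β.symm.trans p.α : H ≃ₐc[k] H) : H →ₗ[k] H).lTensor N.V ∘ₗ N.δ

/-- The conjugate by `p` of `N`, of degree `q`; the vector space is unchanged. -/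
def ModData.conj (p q : AutPair k H) (N : ModData k H) : ModData k H where
  V := N.V
  ρ := conjAct p q N
  δ := conjCoact p N

/-- The linear map `m ⊗ n ↦ n₍₀₎ ⊗ β⁻¹(n₍₁₎) · m`, where `M` has degree `p = (α, β)`. -/
def braidMap (p : AutPair k H) (M N : ModData k H) : M.V ⊗[k] N.V →ₗ[k] N.V ⊗[k] M.V :=
  TensorProduct.lift (LinearMap.lcomp k (N.V ⊗[k] M.V) N.δ ∘ₗ LinearMap.lTensorHom N.V ∘ₗ
    (M.ρ.toLinearMap ∘ₗ (p.β.symm : H →ₗ[k] H)).flip)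

theorem braidMap_tmul (p : AutPair k H) (M N : ModData k H) (m : M.V) (n : N.V) :
    braidMap p M N (m ⊗ₜ n) =
      ((M.ρ.toLinearMap ∘ₗ (p.β.symm : H →ₗ[k] H)).flip m).lTensor N.V (N.δ n) := rfl

end YD

end

/-! Everything rests on rewriting the compatibility condition without the antipode. Multiplying it
on the right by `α(h₁)` and cancelling `S⁻¹(h₂) h₁ = ε(h)` gives the crossing relation `h₁ · v₍₀₎ ⊗
β(h₂) v₍₁₎ = (h₂ · v)₍₀₎ ⊗ (h₂ · v)₍₁₎ α(h₁)`, and `h₂ S⁻¹(h₁) = ε(h)` leads back (`crossed_iff`).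
Bijectivity of `S` enters the proof only here. The crossing relation may be used at `φ(h)` for any
automorphism `φ`, so a tensor product needs just the relation of `N` followed by that of `M`
(`Crossed.tensor`), and a conjugate needs the relation transported along `γ⁻¹βγα⁻¹` and `αβ⁻¹`
(`Crossed.conj`).

The braiding is linear by the crossing relation of `N` (`braidGen_linear`), and colinear by that of
`M` and the coassociativity of `N` (`braidGen_colinear`). The ordinary antipode inverts it
(`braidGen_comm_braidGen`). The hexagon for `c_{X⊗Y,Z}` is coassociativity of the coaction of `Z`;
the one for `c_{X,Y⊗Z}` is multiplicativity of `β⁻¹`, given the order `n₍₁₎ m₍₁₎` in the coaction.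

On the categorical side, the forgetful functor to vector spaces is faithful, so the monoidal
structure is induced along it. Conjugation changes neither spaces nor maps; its laws are equalities
of objects, and its tensor structure consists of `eqToHom`s. The relation `Lies` compares morphisms
through their linear maps and sends every `eqToHom` to an identity, which turns each axiom into an
equation of linear maps. -/

noncomputable section

set_option linter.unusedSectionVars false

/-! ### Sweedler sums -/

namespace YD

section Sweedler

variable {k : Type*} [Field k]
  {A B C D W W' : Type*} [AddCommGroup A] [Module k A] [AddCommGroup B] [Module k B]
  [AddCommGroup C] [Module k C] [AddCommGroup D] [Module k D]
  [AddCommGroup W] [Module k W] [AddCommGroup W'] [Module k W']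

/-- `∑ f aᵢ bᵢ`, for a chosen presentation `t = ∑ aᵢ ⊗ bᵢ`. -/
def sweedler (t : A ⊗[k] B) (f : A → B → W) : W :=
  ∑ i ∈ (TensorProduct.exists_finset t).choose, f i.1 i.2

theorem sweedler_tmul_eq (t : A ⊗[k] B) : sweedler t (fun a b => a ⊗ₜ[k] b) = t :=
  (TensorProduct.exists_finset t).choose_spec.symm

theorem sweedler_congr {t : A ⊗[k] B} {f g : A → B → W} (hfg : ∀ a b, f a b = g a b) :
    sweedler t f = sweedler t g := by
  have : f = g := funext₂ hfg
  rw [this]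

theorem map_sweedler (g : W →ₗ[k] W') (t : A ⊗[k] B) (f : A → B → W) :
    g (sweedler t f) = sweedler t (fun a b => g (f a b)) := by
  simp [sweedler]

/-- The bridge to Sweedler notation: a linear map out of a tensor product can be computed on the
chosen presentation, so the choice does not affect its value. -/
theorem apply_eq_sweedler (g : A ⊗[k] B →ₗ[k] W) (t : A ⊗[k] B) :
    g t = sweedler t (fun a b => g (a ⊗ₜ b)) := by
  rw [← map_sweedler, sweedler_tmul_eq]

/-- Bilinearity of a function of two variables. -/
structure IsBilin (k : Type*) [Field k] {A B W : Type*} [AddCommGroup A] [Module k A]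
    [AddCommGroup B] [Module k B] [AddCommGroup W] [Module k W] (f : A → B → W) : Prop where
  add_left : ∀ a a' b, f (a + a') b = f a b + f a' b
  smul_left : ∀ (c : k) a b, f (c • a) b = c • f a b
  add_right : ∀ a b b', f a (b + b') = f a b + f a b'
  smul_right : ∀ (c : k) a b, f a (c • b) = c • f a b

/-- The linear map on the tensor product defined by a bilinear function. -/
def IsBilin.lift {f : A → B → W} (hf : IsBilin k f) : A ⊗[k] B →ₗ[k] W :=
  TensorProduct.lift (LinearMap.mk₂ k f hf.1 hf.2 hf.3 hf.4)

theorem IsBilin.lift_tmul {f : A → B → W} (hf : IsBilin k f) (a : A) (b : B) :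
    hf.lift (a ⊗ₜ b) = f a b := rfl

theorem IsBilin.lift_apply {f : A → B → W} (hf : IsBilin k f) (t : A ⊗[k] B) :
    hf.lift t = sweedler t f := by
  rw [apply_eq_sweedler]; rfl

/-- Trilinearity of a function of three variables. -/
structure IsTrilin (k : Type*) [Field k] {A B C W : Type*} [AddCommGroup A] [Module k A]
    [AddCommGroup B] [Module k B] [AddCommGroup C] [Module k C] [AddCommGroup W] [Module k W]
    (f : A → B → C → W) : Prop where
  add_left : ∀ a a' b c, f (a + a') b c = f a b c + f a' b c
  smul_left : ∀ (r : k) a b c, f (r • a) b c = r • f a b c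
  bilin : ∀ a, IsBilin k (f a)

/-- The linear map on the tensor product defined by a trilinear function. -/
def IsTrilin.lift {f : A → B → C → W} (hf : IsTrilin k f) : A ⊗[k] (B ⊗[k] C) →ₗ[k] W :=
  TensorProduct.lift
    { toFun := fun a => (hf.bilin a).lift
      map_add' := fun a a' => TensorProduct.ext' fun b c => hf.add_left a a' b c
      map_smul' := fun r a => TensorProduct.ext' fun b c => hf.smul_left r a b c }

theorem IsTrilin.lift_tmul {f : A → B → C → W} (hf : IsTrilin k f) (a : A) (b : B) (c : C) :
    hf.lift (a ⊗ₜ (b ⊗ₜ c)) = f a b c := rfl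

/-- The chosen presentation of the image is unrelated to the image of the chosen presentation.
Bilinearity of `f` makes both sums a value of the same linear map. -/
theorem sweedler_map {f : C → D → W} (hf : IsBilin k f) (g : A →ₗ[k] C) (g' : B →ₗ[k] D)
    (t : A ⊗[k] B) :
    sweedler (TensorProduct.map g g' t) f = sweedler t (fun a b => f (g a) (g' b)) := by
  rw [← hf.lift_apply, ← LinearMap.comp_apply, apply_eq_sweedler]
  rfl

/-- Two iterated comultiplications that agree up to the associator give equal Sweedler sums. -/
theorem sweedler_assoc {f : A → B → C → W} (hf : IsTrilin k f) {s : A ⊗[k] C} {t : A ⊗[k] D}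
    (d : A →ₗ[k] A ⊗[k] B) (e : D →ₗ[k] B ⊗[k] C)
    (h : TensorProduct.assoc k A B C (d.rTensor C s) = e.lTensor A t) :
    sweedler s (fun a c => sweedler (d a) (fun a' b => f a' b c)) =
      sweedler t (fun a b => sweedler (e b) (fun b' c => f a b' c)) := by
  have h1 := congrArg hf.lift h
  rw [← LinearMap.comp_apply, apply_eq_sweedler (hf.lift ∘ₗ e.lTensor A)] at h1
  rw [← LinearEquiv.coe_coe, ← LinearMap.comp_apply, ← LinearMap.comp_apply,
    apply_eq_sweedler] at h1
  refine Eq.trans ?_ (h1.trans ?_)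
  · refine sweedler_congr fun a c => ?_
    simp only [LinearMap.comp_apply, LinearMap.rTensor_tmul]
    conv_rhs => rw [← sweedler_tmul_eq (d a)]
    simp [sweedler, TensorProduct.sum_tmul, hf.lift_tmul]
  · refine sweedler_congr fun a b => ?_
    simp only [LinearMap.comp_apply, LinearMap.lTensor_tmul]
    conv_lhs => rw [← sweedler_tmul_eq (e b)]
    simp [sweedler, TensorProduct.tmul_sum, hf.lift_tmul]

end Sweedler

/-! ### Sweedler calculus in a Hopf algebra -/

section Hopf

variable {k H : Type u} [Field k] [Ring H] [HopfAlgebra k H]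
  {W : Type*} [AddCommGroup W] [Module k W]

/-- `∑ f h₁ h₂`. -/
def sw (k : Type u) {H : Type u} [Field k] [Ring H] [HopfAlgebra k H] {W : Type*}
    [AddCommGroup W] (h : H) (f : H → H → W) : W :=
  sweedler (Coalgebra.comul (R := k) h) f

theorem map_sw {W' : Type*} [AddCommGroup W'] [Module k W'] (g : W →ₗ[k] W') (h : H)
    (f : H → H → W) : g (sw k h f) = sw k h (fun a b => g (f a b)) :=
  map_sweedler g _ f

theorem sw_congr {h : H} {f g : H → H → W} (hfg : ∀ a b, f a b = g a b) :
    sw k h f = sw k h g :=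
  sweedler_congr hfg

theorem sw_add {f : H → H → W} (hf : IsBilin k f) (g h : H) :
    sw k (g + h) f = sw k g f + sw k h f := by
  simp only [sw, ← hf.lift_apply, map_add]

theorem sw_smul {f : H → H → W} (hf : IsBilin k f) (c : k) (h : H) :
    sw k (c • h) f = c • sw k h f := by
  simp only [sw, ← hf.lift_apply, map_smul]

theorem sw_add_fun (h : H) (f g : H → H → W) :
    sw k h (fun a b => f a b + g a b) = sw k h f + sw k h g :=
  Finset.sum_add_distrib

theorem sw_smul_fun (c : k) (h : H) (f : H → H → W) :
    sw k h (fun a b => c • f a b) = c • sw k h f :=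
  Finset.smul_sum.symm

theorem apply_comul (g : H ⊗[k] H →ₗ[k] W) (h : H) :
    g (Coalgebra.comul h) = sw k h (fun a b => g (a ⊗ₜ b)) :=
  apply_eq_sweedler g _

theorem sw_assoc {f : H → H → H → W} (hf : IsTrilin k f) (h : H) :
    sw k h (fun a b => sw k a (fun a₁ a₂ => f a₁ a₂ b)) =
      sw k h (fun a b => sw k b (fun b₁ b₂ => f a b₁ b₂)) :=
  sweedler_assoc hf _ _ (Coalgebra.coassoc_apply h)

theorem sw_equiv {f : H → H → W} (hf : IsBilin k f) (φ : H ≃ₐc[k] H) (h : H) :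
    sw k (φ h) f = sw k h (fun a b => f (φ a) (φ b)) := by
  have := CoalgHomClass.map_comp_comul_apply φ h
  rw [sw, ← this, sweedler_map hf]
  rfl

theorem sw_counit_left (g : H →ₗ[k] W) (h : H) :
    sw k h (fun a b => Coalgebra.counit (R := k) a • g b) = g h := by
  have h1 := Coalgebra.rTensor_counit_comul (R := k) h
  have h2 := congrArg (fun t => g (TensorProduct.lid k H t)) h1
  simp only [TensorProduct.lid_tmul, one_smul] at h2
  rw [← h2]
  exact (apply_comul (g ∘ₗ (TensorProduct.lid k H).toLinearMap ∘ₗ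
    (Coalgebra.counit (R := k)).rTensor H) h |>.trans (sw_congr fun a b => by simp)).symm

theorem sw_counit_right (g : H →ₗ[k] W) (h : H) :
    sw k h (fun a b => Coalgebra.counit (R := k) b • g a) = g h := by
  have h1 := Coalgebra.lTensor_counit_comul (R := k) h
  have h2 := congrArg (fun t => g (TensorProduct.rid k H t)) h1
  simp only [TensorProduct.rid_tmul, one_smul] at h2
  rw [← h2]
  exact (apply_comul (g ∘ₗ (TensorProduct.rid k H).toLinearMap ∘ₗ
    (Coalgebra.counit (R := k)).lTensor H) h |>.trans (sw_congr fun a b => by simp)).symm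

theorem sw_mul_antipode (h : H) :
    sw k h (fun a b => a * HopfAlgebra.antipode k b) = Coalgebra.counit (R := k) h • 1 := by
  have := HopfAlgebra.mul_antipode_lTensor_comul_apply (R := k) h
  rw [← LinearMap.comp_apply, apply_comul] at this
  simpa [Algebra.algebraMap_eq_smul_one] using this

theorem sw_antipode_mul (h : H) :
    sw k h (fun a b => HopfAlgebra.antipode k a * b) = Coalgebra.counit (R := k) h • 1 := by
  have := HopfAlgebra.mul_antipode_rTensor_comul_apply (R := k) h
  rw [← LinearMap.comp_apply, apply_comul] at this
  simpa [Algebra.algebraMap_eq_smul_one] using this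

end Hopf

/-! ### The inverse antipode and cancellation -/

section Antipode

variable {k H : Type u} [Field k] [Ring H] [HopfAlgebra k H] [BijectiveAntipode k H]
  {W : Type*} [AddCommGroup W] [Module k W]

theorem antipode_antipodeInv (h : H) : HopfAlgebra.antipode k (antipodeInv k H h) = h :=
  (LinearEquiv.ofBijective (HopfAlgebra.antipode k : H →ₗ[k] H)
    BijectiveAntipode.bijective).apply_symm_apply h

theorem antipode_injective : Function.Injective (HopfAlgebra.antipode k : H →ₗ[k] H) :=
  BijectiveAntipode.bijective.1

/-- Apply the injective, antimultiplicative `S`: `S(S⁻¹(h₂) h₁) = S(h₁) h₂`, which sums to `ε(h)`.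
The next lemma is the same with `S(h₂ S⁻¹(h₁)) = h₁ S(h₂)`. -/
theorem sw_antipodeInv_mul (h : H) :
    sw k h (fun a b => antipodeInv k H b * a) = Coalgebra.counit (R := k) h • 1 := by
  apply antipode_injective (k := k)
  rw [map_sw, map_smul, HopfAlgebra.antipode_one, ← sw_antipode_mul]
  simp only [HopfAlgebra.antipode_mul_antidistrib, antipode_antipodeInv]

theorem sw_mul_antipodeInv (h : H) :
    sw k h (fun a b => b * antipodeInv k H a) = Coalgebra.counit (R := k) h • 1 := by
  apply antipode_injective (k := k)
  rw [map_sw, map_smul, HopfAlgebra.antipode_one, ← sw_mul_antipode]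
  simp only [HopfAlgebra.antipode_mul_antidistrib, antipode_antipodeInv]

/-- If `g h₁ h₂` is a trivial convolution `ε(h) 1`, then it cancels from Sweedler sums. -/
theorem sw_cancel {K : H → H → W} (hK : IsBilin k K) {g : H → H → H} (hg : IsBilin k g)
    (h1 : ∀ h, sw k h g = Coalgebra.counit (R := k) h • 1) (h : H) :
    sw k h (fun a b => sw k b (fun b₁ b₂ => K (g a b₁) b₂)) = K 1 h := by
  -- Coassociativity groups the two arguments of `g` into one comultiplication; the counit axiom
  -- then absorbs the resulting `ε`.
  rw [← sw_assoc (f := fun a b c => K (g a b) c)]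
  · have h2 : ∀ a b, sw k a (fun a₁ a₂ => K (g a₁ a₂) b) =
        Coalgebra.counit (R := k) a • K 1 b := fun a b => by
      rw [← hK.smul_left, ← h1]
      exact (map_sw ((LinearMap.mk₂ k K hK.1 hK.2 hK.3 hK.4).flip b) a g).symm
    simp only [h2]
    exact sw_counit_left (LinearMap.mk₂ k K hK.1 hK.2 hK.3 hK.4 1) h
  · refine ⟨fun a a' b c => ?_, fun r a b c => ?_, fun a => ⟨fun b b' c => ?_, fun r b c => ?_,
      fun b c c' => ?_, fun r b c => ?_⟩⟩
    · rw [hg.add_left, hK.add_left]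
    · rw [hg.smul_left, hK.smul_left]
    · rw [hg.add_right, hK.add_left]
    · rw [hg.smul_right, hK.smul_left]
    · rw [hK.add_right]
    · rw [hK.smul_right]

end Antipode

/-! ### Action and two-sided multiplication on `V ⊗ H` -/

section Op

variable {k H V : Type*} [Field k] [Ring H] [Algebra k H] [AddCommGroup V] [Module k V]

/-- The endomorphism `v ⊗ x ↦ a · v ⊗ b x c` of `V ⊗ H`. -/
def op (ρ : H →ₐ[k] Module.End k V) (a b c : H) : Module.End k (V ⊗[k] H) :=
  TensorProduct.map (ρ a) (LinearMap.mulLeft k b ∘ₗ LinearMap.mulRight k c)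

variable (ρ : H →ₐ[k] Module.End k V)

@[simp]
theorem op_tmul (a b c x : H) (v : V) : op ρ a b c (v ⊗ₜ x) = ρ a v ⊗ₜ (b * x * c) := by
  simp [op, mul_assoc]

theorem op_op (a b c a' b' c' : H) (t : V ⊗[k] H) :
    op ρ a b c (op ρ a' b' c' t) = op ρ (a * a') (b * b') (c' * c) t := by
  rw [← Module.End.mul_apply]
  congr 1
  exact TensorProduct.ext' fun v x => by simp [mul_assoc]

theorem op_one (t : V ⊗[k] H) : op ρ 1 1 1 t = t := by
  have : op ρ 1 1 1 = LinearMap.id := TensorProduct.ext' fun v x => by simp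
  rw [this]; rfl

/-- Additivity and homogeneity in each slot serve the multilinearity conditions of `sw_equiv`,
`sw_assoc` and `sw_cancel`, whose summands are built from `op`. -/
theorem op_add₁ (a a' b c : H) : op ρ (a + a') b c = op ρ a b c + op ρ a' b c :=
  TensorProduct.ext' fun v x => by simp [TensorProduct.add_tmul]

theorem op_add₂ (a b b' c : H) : op ρ a (b + b') c = op ρ a b c + op ρ a b' c :=
  TensorProduct.ext' fun v x => by simp [TensorProduct.tmul_add, add_mul]

theorem op_add₃ (a b c c' : H) : op ρ a b (c + c') = op ρ a b c + op ρ a b c' :=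
  TensorProduct.ext' fun v x => by simp [TensorProduct.tmul_add, mul_add]

theorem op_smul₁ (r : k) (a b c : H) : op ρ (r • a) b c = r • op ρ a b c :=
  TensorProduct.ext' fun v x => by simp [TensorProduct.smul_tmul']

theorem op_smul₂ (r : k) (a b c : H) : op ρ a (r • b) c = r • op ρ a b c :=
  TensorProduct.ext' fun v x => by simp

theorem op_smul₃ (r : k) (a b c : H) : op ρ a b (r • c) = r • op ρ a b c :=
  TensorProduct.ext' fun v x => by simp

end Op

/-! ### The compatibility condition without the antipode -/

section Crossed

variable {k H : Type u} [Field k] [Ring H] [HopfAlgebra k H]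

/-- The compatibility condition of a Yetter-Drinfeld module, in the form
`h₁ · v₍₀₎ ⊗ β(h₂) v₍₁₎ = (h₂ · v)₍₀₎ ⊗ (h₂ · v)₍₁₎ α(h₁)`, which does not use the antipode. -/
def Crossed {V : Type*} [AddCommGroup V] [Module k V] (p : AutPair k H)
    (ρ : H →ₐ[k] Module.End k V) (δ : V →ₗ[k] V ⊗[k] H) : Prop :=
  ∀ (h : H) (v : V), sw k h (fun a b => op ρ a (p.β b) 1 (δ v)) =
    sw k h (fun a b => op ρ 1 1 (p.α a) (δ (ρ b v)))

/-- The crossing relation at `φ h`, for an automorphism `φ`. -/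
theorem Crossed.equiv {V : Type*} [AddCommGroup V] [Module k V] {p : AutPair k H}
    {ρ : H →ₐ[k] Module.End k V} {δ : V →ₗ[k] V ⊗[k] H} (hM : Crossed p ρ δ) (φ : H ≃ₐc[k] H)
    (h : H) (v : V) : sw k h (fun a b => op ρ (φ a) (p.β (φ b)) 1 (δ v)) =
    sw k h (fun a b => op ρ 1 1 (p.α (φ a)) (δ (ρ (φ b) v))) := by
  have := hM (φ h) v
  rwa [sw_equiv, sw_equiv] at this
  · constructor <;> intros <;> simp [op_add₃, op_smul₃]
  · constructor <;> intros <;> simp [op_add₁, op_add₂, op_smul₁, op_smul₂]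

variable [BijectiveAntipode k H]

theorem ydTwist_eq_sw (p : AutPair k H) (M : ModData k H) (h : H) (t : M.V ⊗[k] H) :
    ydTwist p M ((Coalgebra.comul (R := k) (A := H)).lTensor H (Coalgebra.comul (R := k) h)) t =
      sw k h (fun a b => sw k b (fun b₁ b₂ =>
        op M.ρ b₁ (p.β b₂) (p.α (antipodeInv k H a)) t)) := by
  have h1 : ∀ a b c, ydTwist p M (a ⊗ₜ (b ⊗ₜ c)) t =
      op M.ρ b (p.β c) (p.α (antipodeInv k H a)) t := fun a b c => by
    refine LinearMap.congr_fun (TensorProduct.ext' fun v x => ?_) t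
    rw [ydTwist_tmul, op_tmul]
  have h2 := apply_comul (LinearMap.applyₗ t ∘ₗ ydTwist p M ∘ₗ
    (Coalgebra.comul (R := k) (A := H)).lTensor H) h
  refine h2.trans (sw_congr fun a b => ?_)
  refine (apply_comul (LinearMap.applyₗ t ∘ₗ ydTwist p M ∘ₗ TensorProduct.mk k H (H ⊗[k] H) a)
    b).trans (sw_congr fun b₁ b₂ => h1 a b₁ b₂)

/-- `Crossed` is the compatibility condition of a Yetter-Drinfeld module. -/
theorem crossed_iff (p : AutPair k H) (M : ModData k H) :
    Crossed p M.ρ M.δ ↔ ∀ (h : H) (v : M.V), M.δ (M.ρ h v) =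
      ydTwist p M ((Coalgebra.comul (R := k) (A := H)).lTensor H (Coalgebra.comul (R := k) h))
        (M.δ v) := by
  simp only [ydTwist_eq_sw]
  constructor
  · intro hM h v
    -- The crossing relation at `b`, multiplied on the right by `α(S⁻¹(a))`. In the sum over `a ⊗ b`
    -- this creates `h₂ S⁻¹(h₁)`, which cancels.
    have h1 : ∀ a b : H, sw k b (fun b₁ b₂ => op M.ρ b₁ (p.β b₂) (p.α (antipodeInv k H a)) (M.δ v)) =
        sw k b (fun b₁ b₂ => op M.ρ 1 1 (p.α (b₁ * antipodeInv k H a)) (M.δ (M.ρ b₂ v))) := by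
      intro a b
      have := congrArg (op M.ρ 1 1 (p.α (antipodeInv k H a))) (hM b v)
      simpa [map_sw, op_op] using this
    simp only [h1]
    rw [sw_cancel (K := fun x y => op M.ρ 1 1 (p.α x) (M.δ (M.ρ y v)))
      (g := fun a b => b * antipodeInv k H a) _ _ sw_mul_antipodeInv]
    · simp [op_one]
    · constructor <;> intros <;> simp [op_add₃, op_smul₃]
    · constructor <;> intros <;> simp [mul_add, add_mul]
  · intro hM h v
    -- Inserting the compatibility condition on the right-hand side produces the factor `α(S⁻¹(h₂)
    -- h₁)`, which cancels.
    simp only [hM, map_sw, op_op, one_mul, ← map_mul]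
    have hb : ∀ c : H, IsBilin k (fun a b => op M.ρ a (p.β b) c (M.δ v)) := fun c => by
      constructor <;> intros <;> simp [op_add₁, op_add₂, op_smul₁, op_smul₂]
    rw [sw_cancel (K := fun x y => sw k y (fun a b => op M.ρ a (p.β b) (p.α x) (M.δ v)))
      (g := fun a b => antipodeInv k H b * a) _ _ sw_antipodeInv_mul]
    · simp
    · constructor <;> intros <;> simp [op_add₃, op_smul₃, sw_add_fun, sw_smul_fun,
        sw_add (hb _), sw_smul (hb _)]
    · constructor <;> intros <;> simp [mul_add, add_mul]

theorem YDMod.crossed {p : AutPair k H} (M : YDMod k H p) : Crossed p M.ρ M.δ :=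
  (crossed_iff p _).2 M.compat

end Crossed

/-! ### Tensor products of Yetter-Drinfeld modules -/

section TensorProduct

variable {k H : Type u} [Field k] [Ring H] [HopfAlgebra k H]

/-- The map `(v ⊗ a) ⊗ (w ⊗ b) ↦ (v ⊗ w) ⊗ b a`. -/
def opMul (k : Type*) [Field k] (V W A : Type*) [AddCommGroup V] [Module k V] [AddCommGroup W]
    [Module k W] [Ring A] [Algebra k A] :
    (V ⊗[k] A) ⊗[k] (W ⊗[k] A) →ₗ[k] (V ⊗[k] W) ⊗[k] A :=
  (LinearMap.mul' k A ∘ₗ (TensorProduct.comm k A A).toLinearMap).lTensor (V ⊗[k] W) ∘ₗ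
    (TensorProduct.tensorTensorTensorComm k V A W A).toLinearMap

@[simp]
theorem opMul_tmul {V W A : Type*} [AddCommGroup V] [Module k V] [AddCommGroup W]
    [Module k W] [Ring A] [Algebra k A] (v : V) (w : W) (a b : A) :
    opMul k V W A ((v ⊗ₜ a) ⊗ₜ (w ⊗ₜ b)) = (v ⊗ₜ w) ⊗ₜ (b * a) := by
  simp [opMul]

theorem tensorCoact_tmul (M N : ModData k H) (m : M.V) (n : N.V) :
    tensorCoact M N (m ⊗ₜ n) = opMul k M.V N.V H (M.δ m ⊗ₜ N.δ n) := rfl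

theorem tensorAct_tmul (p q : AutPair k H) (M N : ModData k H) (h : H) (m : M.V) (n : N.V) :
    tensorAct p q M N h (m ⊗ₜ n) =
      sw k h (fun a b => M.ρ (q.α a) m ⊗ₜ N.ρ (p.twist q b) n) := by
  have := apply_comul (LinearMap.applyₗ (m ⊗ₜ[k] n) ∘ₗ
    (Module.endTensorEndAlgHom (R := k) (S := k) (A := k) (M := M.V) (N := N.V)).toLinearMap ∘ₗ
    (Algebra.TensorProduct.map (M.ρ.comp (q.α : H →ₐ[k] H))
      (N.ρ.comp (p.twist q : H →ₐ[k] H))).toLinearMap) h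
  exact this

/-- In `n₍₁₎ m₍₁₎` the two legs touch: a factor to the left of `m₍₁₎` is a factor to the right of
`n₍₁₎`. This passes `β` of `M` to the side of `N` where its crossing relation needs it. -/
theorem opMul_op_left (M N : ModData k H) (a b : H) (s : M.V ⊗[k] H) (t : N.V ⊗[k] H) :
    opMul k M.V N.V H (op M.ρ a b 1 s ⊗ₜ t) = opMul k M.V N.V H (op M.ρ a 1 1 s ⊗ₜ op N.ρ 1 1 b t) := by
  induction s with
  | zero => simp
  | add s s' hs hs' => simp only [map_add, TensorProduct.add_tmul, hs, hs']
  | tmul v x =>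
    induction t with
    | zero => simp
    | add t t' ht ht' => simp only [map_add, TensorProduct.tmul_add, ht, ht']
    | tmul w y => simp [mul_assoc]

theorem op_tensor_left (p q : AutPair k H) (M N : ModData k H) (a b : H) (s : M.V ⊗[k] H)
    (t : N.V ⊗[k] H) :
    op (tensorAct p q M N) a b 1 (opMul k M.V N.V H (s ⊗ₜ t)) =
      sw k a (fun a₁ a₂ =>
        opMul k M.V N.V H (op M.ρ (q.α a₁) 1 1 s ⊗ₜ op N.ρ (p.twist q a₂) b 1 t)) := by
  induction s with
  | zero => simp [sw, sweedler]
  | add s s' hs hs' => simp only [map_add, TensorProduct.add_tmul, hs, hs', sw_add_fun]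
  | tmul v x =>
    induction t with
    | zero => simp [sw, sweedler]
    | add t t' ht ht' => simp only [map_add, TensorProduct.tmul_add, ht, ht', sw_add_fun]
    | tmul w y =>
      rw [opMul_tmul, op_tmul]
      refine (congrArg (· ⊗ₜ[k] (b * (y * x) * 1)) (tensorAct_tmul p q M N a v w)).trans ?_
      refine (map_sw ((TensorProduct.mk k _ H).flip _) a _).trans (sw_congr fun a₁ a₂ => ?_)
      simp [mul_assoc]

theorem op_tensor_right (p q : AutPair k H) (M N : ModData k H) (c : H) (s : M.V ⊗[k] H)
    (t : N.V ⊗[k] H) :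
    op (tensorAct p q M N) 1 1 c (opMul k M.V N.V H (s ⊗ₜ t)) =
      opMul k M.V N.V H (op M.ρ 1 1 c s ⊗ₜ t) := by
  induction s with
  | zero => simp
  | add s s' hs hs' => simp only [map_add, TensorProduct.add_tmul, hs, hs']
  | tmul v x =>
    induction t with
    | zero => simp
    | add t t' ht ht' => simp only [map_add, TensorProduct.tmul_add, ht, ht']
    | tmul w y =>
      rw [opMul_tmul, op_tmul]
      simp [mul_assoc]

/-- The crossing relation of `N` at `γ⁻¹βγ(h)` leaves the factor `γγ⁻¹βγ(h₁) = βγ(h₁)` to the right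
of `n₍₁₎`. Read as a factor to the left of `m₍₁₎`, it is what the crossing relation of `M` at `γ(h)`
consumes, leaving `αγ(h₁)` on the far right. Coassociativity regroups the legs between the two
moves. -/
theorem Crossed.tensor {p q : AutPair k H} {M N : ModData k H} (hM : Crossed p M.ρ M.δ)
    (hN : Crossed q N.ρ N.δ) : Crossed (p * q) (tensorAct p q M N) (tensorCoact M N) := by
  intro h v
  induction v with
  | zero => simp
  | add v v' hv hv' => simp only [map_add, sw_add_fun, hv, hv']
  | tmul m n =>
    have hL : ∀ a b : H, op (tensorAct p q M N) a ((p * q).β b) 1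
        (tensorCoact M N (m ⊗ₜ n)) = sw k a (fun a₁ a₂ =>
        opMul k M.V N.V H (op M.ρ (q.α a₁) 1 1 (M.δ m) ⊗ₜ
          op N.ρ (p.twist q a₂) (q.β (p.twist q b)) 1 (N.δ n))) := fun a b =>
      op_tensor_left p q M N a _ _ _
    have hR : ∀ a b : H, op (tensorAct p q M N) 1 1 ((p * q).α a)
        (tensorCoact M N (tensorAct p q M N b (m ⊗ₜ n))) =
        sw k b (fun b₁ b₂ => opMul k M.V N.V H
          (op M.ρ 1 1 (p.α (q.α a)) (M.δ (M.ρ (q.α b₁) m)) ⊗ₜ N.δ (N.ρ (p.twist q b₂) n))) := by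
      intro a b
      refine (congrArg (fun t => op (tensorAct p q M N) 1 1 ((p * q).α a)
        (tensorCoact M N t)) (tensorAct_tmul p q M N b m n)).trans ?_
      refine (map_sw (op (tensorAct p q M N) 1 1 ((p * q).α a) ∘ₗ
        tensorCoact M N) b _).trans (sw_congr fun b₁ b₂ => ?_)
      exact op_tensor_right p q M N _ _ _
    have hN' : ∀ a b : H, sw k b (fun b₁ b₂ =>
        opMul k M.V N.V H (op M.ρ (q.α a) 1 1 (M.δ m) ⊗ₜ
          op N.ρ (p.twist q b₁) (q.β (p.twist q b₂)) 1 (N.δ n))) =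
        sw k b (fun b₁ b₂ => opMul k M.V N.V H (op M.ρ (q.α a) (p.β (q.α b₁)) 1 (M.δ m) ⊗ₜ
          N.δ (N.ρ (p.twist q b₂) n))) := fun a b => by
      have := congrArg (opMul k M.V N.V H ∘ₗ TensorProduct.mk k _ _ (op M.ρ (q.α a) 1 1 (M.δ m)))
        (hN.equiv (p.twist q) b n)
      rw [map_sw, map_sw] at this
      refine this.trans (sw_congr fun b₁ b₂ => ?_)
      rw [opMul_op_left M N (q.α a) (p.β (q.α b₁))]
      -- The reason for twisting the second factor by `γ⁻¹βγ`: after `γ`, what remains is `βγ`.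
      have : q.α (p.twist q b₁) = p.β (q.α b₁) := q.α.apply_symm_apply _
      rw [this]
      rfl
    have hM' : ∀ a b : H, sw k a (fun a₁ a₂ =>
        opMul k M.V N.V H (op M.ρ (q.α a₁) (p.β (q.α a₂)) 1 (M.δ m) ⊗ₜ
          N.δ (N.ρ (p.twist q b) n))) =
        sw k a (fun a₁ a₂ => opMul k M.V N.V H
          (op M.ρ 1 1 (p.α (q.α a₁)) (M.δ (M.ρ (q.α a₂) m)) ⊗ₜ N.δ (N.ρ (p.twist q b) n))) :=
        fun a b => by
      have := congrArg (opMul k M.V N.V H ∘ₗ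
        (TensorProduct.mk k _ _).flip (N.δ (N.ρ (p.twist q b) n))) (hM.equiv q.α a m)
      rw [map_sw, map_sw] at this
      exact this
    simp only [hL, hR]
    rw [sw_assoc (f := fun a b c => opMul k M.V N.V H (op M.ρ (q.α a) 1 1 (M.δ m) ⊗ₜ
          op N.ρ (p.twist q b) (q.β (p.twist q c)) 1 (N.δ n)))]
    · simp only [hN']
      rw [← sw_assoc (f := fun a b c => opMul k M.V N.V H
        (op M.ρ (q.α a) (p.β (q.α b)) 1 (M.δ m) ⊗ₜ N.δ (N.ρ (p.twist q c) n)))]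
      · simp only [hM']
        rw [sw_assoc (f := fun a b c => opMul k M.V N.V H
          (op M.ρ 1 1 (p.α (q.α a)) (M.δ (M.ρ (q.α b) m)) ⊗ₜ N.δ (N.ρ (p.twist q c) n)))]
        refine ⟨?_, ?_, fun a => ⟨?_, ?_, ?_, ?_⟩⟩ <;> intros <;>
          simp [op_add₃, op_smul₃, TensorProduct.add_tmul, TensorProduct.tmul_add,
            ← TensorProduct.smul_tmul']
      · refine ⟨?_, ?_, fun a => ⟨?_, ?_, ?_, ?_⟩⟩ <;> intros <;>
          simp [op_add₁, op_smul₁, op_add₂, op_smul₂, TensorProduct.add_tmul,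
            TensorProduct.tmul_add, ← TensorProduct.smul_tmul']
    · refine ⟨?_, ?_, fun a => ⟨?_, ?_, ?_, ?_⟩⟩ <;> intros <;>
        simp [op_add₁, op_smul₁, op_add₂, op_smul₂,
          TensorProduct.add_tmul, TensorProduct.tmul_add, ← TensorProduct.smul_tmul']

variable [BijectiveAntipode k H]

/-- Since the comultiplication is multiplicative, both sides are `opMul` with coefficients in `H ⊗
H`, applied to the two iterated coactions of `M` and of `N`. -/
theorem tensorCoact_coassoc {p q : AutPair k H} (M : YDMod k H p) (N : YDMod k H q) :
    (Coalgebra.comul (R := k) (A := H)).lTensor (M.V ⊗[k] N.V) ∘ₗ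
      tensorCoact M.toModData N.toModData =
    (TensorProduct.assoc k (M.V ⊗[k] N.V) H H).toLinearMap ∘ₗ
      (tensorCoact M.toModData N.toModData).rTensor H ∘ₗ
      tensorCoact M.toModData N.toModData := by
  have hl : ∀ (s : M.V ⊗[k] H) (t : N.V ⊗[k] H),
      (Coalgebra.comul (R := k) (A := H)).lTensor (M.V ⊗[k] N.V) (opMul k M.V N.V H (s ⊗ₜ t)) =
      opMul k M.V N.V (H ⊗[k] H) ((Coalgebra.comul (R := k) (A := H)).lTensor M.V s ⊗ₜ
        (Coalgebra.comul (R := k) (A := H)).lTensor N.V t) := by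
    intro s t
    induction s with
    | zero => simp
    | add s s' hs hs' => simp only [map_add, TensorProduct.add_tmul, hs, hs']
    | tmul v x =>
      induction t with
      | zero => simp
      | add t t' ht ht' => simp only [map_add, TensorProduct.tmul_add, ht, ht']
      | tmul w y => simp
  have hr' : ∀ (s : M.V ⊗[k] H) (t : N.V ⊗[k] H) (x y : H),
      TensorProduct.assoc k (M.V ⊗[k] N.V) H H (opMul k M.V N.V H (s ⊗ₜ t) ⊗ₜ (y * x)) =
      opMul k M.V N.V (H ⊗[k] H) (TensorProduct.assoc k M.V H H (s ⊗ₜ x) ⊗ₜ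
        TensorProduct.assoc k N.V H H (t ⊗ₜ y)) := by
    intro s t x y
    induction s with
    | zero => simp
    | add s s' hs hs' => simp only [map_add, TensorProduct.add_tmul, hs, hs']
    | tmul v x =>
      induction t with
      | zero => simp
      | add t t' ht ht' =>
        simp only [map_add, TensorProduct.tmul_add, TensorProduct.add_tmul, ht, ht']
      | tmul w y => simp
  have hr : ∀ (s : M.V ⊗[k] H) (t : N.V ⊗[k] H),
      TensorProduct.assoc k (M.V ⊗[k] N.V) H H
        ((tensorCoact M.toModData N.toModData).rTensor H (opMul k M.V N.V H (s ⊗ₜ t))) =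
      opMul k M.V N.V (H ⊗[k] H) (TensorProduct.assoc k M.V H H (M.δ.rTensor H s) ⊗ₜ
        TensorProduct.assoc k N.V H H (N.δ.rTensor H t)) := by
    intro s t
    induction s with
    | zero => simp
    | add s s' hs hs' => simp only [map_add, TensorProduct.add_tmul, hs, hs']
    | tmul v x =>
      induction t with
      | zero => simp
      | add t t' ht ht' => simp only [map_add, TensorProduct.tmul_add, ht, ht']
      | tmul w y =>
        rw [opMul_tmul, LinearMap.rTensor_tmul, tensorCoact_tmul, hr']
        rfl
  refine TensorProduct.ext' fun m n => ?_
  have hm := LinearMap.congr_fun M.coassoc m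
  have hn := LinearMap.congr_fun N.coassoc n
  simp only [LinearMap.comp_apply, LinearEquiv.coe_coe] at hm hn ⊢
  rw [tensorCoact_tmul, hl, hr, hm, hn]

theorem tensorCoact_counit {p q : AutPair k H} (M : YDMod k H p) (N : YDMod k H q) :
    (TensorProduct.rid k (M.V ⊗[k] N.V)).toLinearMap ∘ₗ
      (Coalgebra.counit (R := k) (A := H)).lTensor (M.V ⊗[k] N.V) ∘ₗ
      tensorCoact M.toModData N.toModData = LinearMap.id := by
  have hl : ∀ (s : M.V ⊗[k] H) (t : N.V ⊗[k] H), TensorProduct.rid k (M.V ⊗[k] N.V)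
      ((Coalgebra.counit (R := k) (A := H)).lTensor (M.V ⊗[k] N.V)
        (opMul k M.V N.V H (s ⊗ₜ t))) =
      TensorProduct.rid k M.V ((Coalgebra.counit (R := k) (A := H)).lTensor M.V s) ⊗ₜ
        TensorProduct.rid k N.V ((Coalgebra.counit (R := k) (A := H)).lTensor N.V t) := by
    intro s t
    induction s with
    | zero => simp
    | add s s' hs hs' => simp only [map_add, TensorProduct.add_tmul, hs, hs']
    | tmul v x =>
      induction t with
      | zero => simp
      | add t t' ht ht' => simp only [map_add, TensorProduct.tmul_add, ht, ht']
      | tmul w y => simp [TensorProduct.smul_tmul', smul_smul, mul_comm]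
  refine TensorProduct.ext' fun m n => ?_
  have hm := LinearMap.congr_fun M.counit m
  have hn := LinearMap.congr_fun N.counit n
  simp only [LinearMap.comp_apply, LinearEquiv.coe_coe] at hm hn ⊢
  rw [tensorCoact_tmul, hl, hm, hn]
  rfl

/-- The tensor product of Yetter-Drinfeld modules. -/
def YDMod.tensor {p q : AutPair k H} (M : YDMod k H p) (N : YDMod k H q) :
    YDMod k H (p * q) where
  toModData := ModData.tensor p q M.toModData N.toModData
  coassoc := tensorCoact_coassoc M N
  counit := tensorCoact_counit M N
  compat := (crossed_iff _ _).1 (M.crossed.tensor N.crossed)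

end TensorProduct

/-! ### The unit object -/

section Unit

variable {k H : Type u} [Field k] [Ring H] [HopfAlgebra k H]

/-- The trivial action on the ground field. -/
def unitAct (k H : Type u) [Field k] [Ring H] [HopfAlgebra k H] : H →ₐ[k] Module.End k k :=
  (Algebra.ofId k (Module.End k k)).comp (Bialgebra.counitAlgHom k H)

theorem unitAct_apply (h : H) (v : k) :
    unitAct k H h v = Coalgebra.counit (R := k) h • v := rfl

/-- Both sides collapse to `v ⊗ h`, by the left and the right counit axiom respectively. -/
theorem crossed_unit : Crossed 1 (unitAct k H) ((TensorProduct.mk k k H).flip 1) := by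
  intro h v
  have h1 : ∀ a b : H, op (unitAct k H) a ((1 : AutPair k H).β b) 1
      ((TensorProduct.mk k k H).flip 1 v) = Coalgebra.counit (R := k) a • (v ⊗ₜ[k] b) :=
    fun a b => by
      rw [LinearMap.flip_apply, TensorProduct.mk_apply, op_tmul, unitAct_apply,
        ← TensorProduct.smul_tmul', mul_one, mul_one]
      rfl
  have h2 : ∀ a b : H, op (unitAct k H) 1 1 ((1 : AutPair k H).α a)
      ((TensorProduct.mk k k H).flip 1 (unitAct k H b v)) =
      Coalgebra.counit (R := k) b • (v ⊗ₜ[k] a) := fun a b => by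
    rw [LinearMap.flip_apply, TensorProduct.mk_apply, op_tmul, map_one, unitAct_apply,
      TensorProduct.smul_tmul', mul_one, one_mul]
    rfl
  simp only [h1, h2]
  exact (sw_counit_left (TensorProduct.mk k k H v) h).trans
    (sw_counit_right (TensorProduct.mk k k H v) h).symm

variable [BijectiveAntipode k H]

/-- The unit object. -/
def YDMod.unit (k H : Type u) [Field k] [Ring H] [HopfAlgebra k H] [BijectiveAntipode k H] :
    YDMod k H 1 where
  toModData := ModData.unit k H
  coassoc := LinearMap.ext fun (v : k) => by
    change (Coalgebra.comul (R := k) (A := H)).lTensor k (v ⊗ₜ[k] (1 : H)) = v ⊗ₜ (1 ⊗ₜ 1)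
    simp [Algebra.TensorProduct.one_def]
  counit := LinearMap.ext fun (v : k) => by
    change TensorProduct.rid k k ((Coalgebra.counit (R := k) (A := H)).lTensor k
      (v ⊗ₜ[k] (1 : H))) = v
    simp
  compat := (crossed_iff _ _).1 crossed_unit

end Unit

/-! ### Conjugates of Yetter-Drinfeld modules -/

section Conj

variable {k H : Type u} [Field k] [Ring H] [HopfAlgebra k H]

/-- The automorphism `γ⁻¹βγα⁻¹` by which the action of a conjugate is twisted. -/
def AutPair.actTwist (p q : AutPair k H) : H ≃ₐc[k] H := p.α.symm.trans (p.twist q)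

/-- The automorphism `αβ⁻¹` by which the coaction of a conjugate is twisted. -/
def AutPair.coactTwist (p : AutPair k H) : H ≃ₐc[k] H := p.β.symm.trans p.α

/-- This and its companion for `β` explain the degree of a conjugate: twisting the action and the
coaction alters both components of `q` by the same pre- and postcomposition. -/
theorem AutPair.conj_α_apply (p q : AutPair k H) (h : H) :
    (p * q * p⁻¹).α h = p.coactTwist (q.α (p.actTwist q h)) := by
  change p.α (q.α (p.α.symm h)) =
    p.α (p.β.symm (q.α (q.α.symm (p.β (q.α (p.α.symm h))))))
  simp

theorem AutPair.conj_β_apply (p q : AutPair k H) (h : H) :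
    (p * q * p⁻¹).β h = p.coactTwist (q.β (p.actTwist q h)) := by
  change p.α (p.β.symm (p.α.symm (p.α (q.β (q.α.symm (p.β (q.α (p.α.symm h)))))))) =
    p.α (p.β.symm (q.β (q.α.symm (p.β (q.α (p.α.symm h))))))
  simp

/-- The map `v ⊗ x ↦ v ⊗ αβ⁻¹(x)`. -/
def coactTwistMap (p : AutPair k H) (V : Type*) [AddCommGroup V] [Module k V] :
    V ⊗[k] H →ₗ[k] V ⊗[k] H :=
  (p.coactTwist : H →ₗ[k] H).lTensor V

@[simp]
theorem coactTwistMap_tmul (p : AutPair k H) {V : Type*} [AddCommGroup V] [Module k V] (v : V)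
    (x : H) : coactTwistMap p V (v ⊗ₜ x) = v ⊗ₜ p.coactTwist x := rfl

theorem op_conj (p q : AutPair k H) (N : ModData k H) (a b c : H) (t : N.V ⊗[k] H) :
    op (conjAct p q N) a (p.coactTwist b) (p.coactTwist c) (coactTwistMap p N.V t) =
      coactTwistMap p N.V (op N.ρ (p.actTwist q a) b c t) := by
  induction t with
  | zero => simp
  | add t t' ht ht' => simp only [map_add, ht, ht']
  | tmul v x =>
    rw [coactTwistMap_tmul, op_tmul, op_tmul, coactTwistMap_tmul, map_mul,
      map_mul]
    rfl

/-- The crossing relation of `N` at `γ⁻¹βγα⁻¹(h)`, with the algebra automorphism `αβ⁻¹` applied to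
its `H`-leg. -/
theorem Crossed.conj {q : AutPair k H} {N : ModData k H} (hN : Crossed q N.ρ N.δ) (p : AutPair k H) :
    Crossed (p * q * p⁻¹) (conjAct p q N) (conjCoact p N) := by
  intro h v
  have := congrArg (coactTwistMap p N.V) (hN.equiv (p.actTwist q) h v)
  rw [map_sw, map_sw] at this
  refine Eq.trans (sw_congr fun a b => ?_) (this.trans (sw_congr fun a b => ?_))
  · rw [← op_conj, ← AutPair.conj_β_apply, map_one]
    rfl
  -- `op_conj` can be read backwards only if the acting element is a value of the action twist, so
  -- `1` is written as one.
  · rw [← map_one (p.actTwist q), ← op_conj, ← AutPair.conj_α_apply, map_one, map_one]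
    rfl

variable [BijectiveAntipode k H]

/-- As `αβ⁻¹` is a coalgebra map, it acts on both `H`-legs of the iterated coaction of `N`, on
either side of the equation. -/
theorem conjCoact_coassoc (p : AutPair k H) {q : AutPair k H} (N : YDMod k H q) :
    (Coalgebra.comul (R := k) (A := H)).lTensor N.V ∘ₗ conjCoact p N.toModData =
      (TensorProduct.assoc k N.V H H).toLinearMap ∘ₗ
        (conjCoact p N.toModData).rTensor H ∘ₗ conjCoact p N.toModData := by
  have hl : ∀ t : N.V ⊗[k] H,
      (Coalgebra.comul (R := k) (A := H)).lTensor N.V (coactTwistMap p N.V t) =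
      (TensorProduct.map (p.coactTwist : H →ₗ[k] H) (p.coactTwist : H →ₗ[k] H)).lTensor N.V
        ((Coalgebra.comul (R := k) (A := H)).lTensor N.V t) := by
    intro t
    induction t with
    | zero => simp
    | add t t' ht ht' => simp only [map_add, ht, ht']
    | tmul v x =>
      simp only [coactTwistMap_tmul, LinearMap.lTensor_tmul]
      exact congrArg (v ⊗ₜ[k] ·) (CoalgHomClass.map_comp_comul_apply p.coactTwist x).symm
  have hr : ∀ t : N.V ⊗[k] H, TensorProduct.assoc k N.V H H
      ((conjCoact p N.toModData).rTensor H (coactTwistMap p N.V t)) =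
      (TensorProduct.map (p.coactTwist : H →ₗ[k] H) (p.coactTwist : H →ₗ[k] H)).lTensor N.V
        (TensorProduct.assoc k N.V H H (N.δ.rTensor H t)) := by
    intro t
    induction t with
    | zero => simp
    | add t t' ht ht' => simp only [map_add, ht, ht']
    | tmul v x =>
      simp only [coactTwistMap_tmul, LinearMap.rTensor_tmul]
      change TensorProduct.assoc k N.V H H (coactTwistMap p N.V (N.δ v) ⊗ₜ _) = _
      generalize N.δ v = s
      induction s with
      | zero => simp
      | add s s' hs hs' => simp only [map_add, TensorProduct.add_tmul, hs, hs']
      | tmul w y => simp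
  refine LinearMap.ext fun n => ?_
  have hn := LinearMap.congr_fun N.coassoc n
  simp only [LinearMap.comp_apply, LinearEquiv.coe_coe] at hn ⊢
  exact (hl _).trans ((congrArg _ hn).trans (hr _).symm)

theorem conjCoact_counit (p : AutPair k H) {q : AutPair k H} (N : YDMod k H q) :
    (TensorProduct.rid k N.V).toLinearMap ∘ₗ
      (Coalgebra.counit (R := k) (A := H)).lTensor N.V ∘ₗ conjCoact p N.toModData =
      LinearMap.id := by
  rw [← N.counit]
  have : (Coalgebra.counit (R := k) (A := H)) ∘ₗ (p.coactTwist : H →ₗ[k] H) =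
      Coalgebra.counit (R := k) (A := H) :=
    CoalgHomClass.counit_comp p.coactTwist
  conv_rhs => rw [← this, LinearMap.lTensor_comp]
  rfl

/-- The conjugate of a Yetter-Drinfeld module. -/
def YDMod.conj (p : AutPair k H) {q : AutPair k H} (N : YDMod k H q) :
    YDMod k H (p * q * p⁻¹) where
  toModData := ModData.conj p q N.toModData
  coassoc := conjCoact_coassoc p N
  counit := conjCoact_counit p N
  compat := (crossed_iff _ _).1 (N.crossed.conj p)

end Conj

/-! ### Morphisms of the disjoint union as linear maps -/

section Hom

variable {k H : Type u} [Field k] [Ring H] [HopfAlgebra k H]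

/-- A linear map is a morphism of modules and comodules. -/
structure IsYDHom (M N : ModData k H) (f : M.V →ₗ[k] N.V) : Prop where
  linear : ∀ (h : H) (v : M.V), f (M.ρ h v) = N.ρ h (f v)
  colinear : ∀ v : M.V, f.rTensor H (M.δ v) = N.δ (f v)

theorem IsYDHom.symm {M N : ModData k H} (e : M.V ≃ₗ[k] N.V) (he : IsYDHom M N e) :
    IsYDHom N M e.symm where
  linear h v := by
    apply e.injective
    have := he.linear h (e.symm v)
    simp only [LinearEquiv.coe_coe] at this ⊢
    rw [this]
    simp
  colinear v := by
    have := congrArg ((e.symm : N.V →ₗ[k] M.V).rTensor H) (he.colinear (e.symm v))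
    rw [← LinearMap.comp_apply, ← LinearMap.rTensor_comp] at this
    simpa using this.symm

variable [BijectiveAntipode k H]

/-- The linear map underlying a morphism. -/
def lin {X Y : Σ p : AutPair k H, YDMod k H p} (f : X ⟶ Y) : X.2.V →ₗ[k] Y.2.V :=
  ((forget k H).map f).hom

theorem isYDHom_lin {X Y : Σ p : AutPair k H, YDMod k H p} (f : X ⟶ Y) :
    IsYDHom X.2.toModData Y.2.toModData (lin f) := by
  rcases f with ⟨f⟩
  exact ⟨f.linear, fun v => LinearMap.congr_fun f.colinear v⟩

/-- The morphism of `YD(H)` defined by a linear and colinear map. -/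
def mkHom : ∀ {X Y : Σ p : AutPair k H, YDMod k H p} (_ : X.1 = Y.1)
    (f : X.2.V →ₗ[k] Y.2.V) (_ : IsYDHom X.2.toModData Y.2.toModData f), X ⟶ Y
  | ⟨p, _⟩, ⟨q, _⟩, h, f, hf => by
    obtain rfl : p = q := h
    exact Sigma.SigmaHom.mk ⟨f, hf.linear, LinearMap.ext hf.colinear⟩

@[simp]
theorem forget_map_mkHom {X Y : Σ p : AutPair k H, YDMod k H p} (h : X.1 = Y.1)
    (f : X.2.V →ₗ[k] Y.2.V) (hf : IsYDHom X.2.toModData Y.2.toModData f) :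
    (forget k H).map (mkHom h f hf) = ModuleCat.ofHom f := by
  rcases X with ⟨p, X⟩
  rcases Y with ⟨q, Y⟩
  obtain rfl : p = q := h
  rfl

instance : (forget k H).Faithful where
  map_injective := by
    rintro ⟨p, X⟩ ⟨_, Y⟩ ⟨f⟩ ⟨g⟩ hfg
    exact congrArg Sigma.SigmaHom.mk (YDMod.Hom.ext (congrArg ModuleCat.Hom.hom hfg))

/-- The isomorphism of `YD(H)` defined by a linear and colinear equivalence. -/
def mkIso {X Y : Σ p : AutPair k H, YDMod k H p} (h : X.1 = Y.1) (e : X.2.V ≃ₗ[k] Y.2.V)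
    (he : IsYDHom X.2.toModData Y.2.toModData e) : X ≅ Y where
  hom := mkHom h e he
  inv := mkHom h.symm e.symm he.symm
  hom_inv_id := (forget k H).map_injective <| by
    rw [Functor.map_comp, forget_map_mkHom, forget_map_mkHom, (forget k H).map_id]
    exact congrArg ModuleCat.ofHom (LinearMap.ext fun v => e.symm_apply_apply v)
  inv_hom_id := (forget k H).map_injective <| by
    rw [Functor.map_comp, forget_map_mkHom, forget_map_mkHom, (forget k H).map_id]
    exact congrArg ModuleCat.ofHom (LinearMap.ext fun v => e.apply_symm_apply v)

/-- The Yetter-Drinfeld axioms are propositions, so they impose nothing further. -/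
theorem obj_ext {X Y : Σ p : AutPair k H, YDMod k H p} (h : X.1 = Y.1)
    (h' : X.2.toModData = Y.2.toModData) : X = Y := by
  rcases X with ⟨p, X⟩
  rcases Y with ⟨q, Y⟩
  obtain rfl : p = q := h
  cases X
  cases Y
  cases h'
  rfl

end Hom

/-! ### Linearity and colinearity of the monoidal structure maps -/

section Tensor

variable {k H : Type u} [Field k] [Ring H] [HopfAlgebra k H]

theorem opMul_map {V W V' W' : Type*} [AddCommGroup V] [Module k V] [AddCommGroup W]
    [Module k W] [AddCommGroup V'] [Module k V'] [AddCommGroup W'] [Module k W']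
    (f : V →ₗ[k] V') (g : W →ₗ[k] W') (s : V ⊗[k] H) (t : W ⊗[k] H) :
    (TensorProduct.map f g).rTensor H (opMul k V W H (s ⊗ₜ t)) =
      opMul k V' W' H (f.rTensor H s ⊗ₜ g.rTensor H t) := by
  induction s with
  | zero => simp
  | add s s' hs hs' => simp only [map_add, TensorProduct.add_tmul, hs, hs']
  | tmul v x =>
    induction t with
    | zero => simp
    | add t t' ht ht' => simp only [map_add, TensorProduct.tmul_add, ht, ht']
    | tmul w y => simp

/-- Degrees are compared by hypotheses because a morphism of the disjoint union only yields a
propositional equality of the degrees of its ends. -/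
theorem IsYDHom.tensor {p p' q q' : AutPair k H} (hp : p = p') (hq : q = q')
    {M M' N N' : ModData k H} {f : M.V →ₗ[k] M'.V} {g : N.V →ₗ[k] N'.V} (hf : IsYDHom M M' f)
    (hg : IsYDHom N N' g) :
    IsYDHom (ModData.tensor p q M N) (ModData.tensor p' q' M' N') (TensorProduct.map f g) := by
  subst hp hq
  constructor
  · intro h
    refine LinearMap.congr_fun (f := TensorProduct.map f g ∘ₗ tensorAct p q M N h)
      (g := tensorAct p q M' N' h ∘ₗ TensorProduct.map f g) (TensorProduct.ext' fun m n => ?_)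
    rw [LinearMap.comp_apply, LinearMap.comp_apply, TensorProduct.map_tmul, tensorAct_tmul,
      tensorAct_tmul, map_sw]
    simp [hf.linear, hg.linear]
  · refine LinearMap.congr_fun (f := (TensorProduct.map f g).rTensor H ∘ₗ tensorCoact M N)
      (g := tensorCoact M' N' ∘ₗ TensorProduct.map f g) (TensorProduct.ext' fun m n => ?_)
    rw [LinearMap.comp_apply, LinearMap.comp_apply, TensorProduct.map_tmul, tensorCoact_tmul,
      tensorCoact_tmul, opMul_map, hf.colinear, hg.colinear]

/-- Matches the automorphisms through which `h` acts on the third factor in the two bracketings; the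
next lemma does so for the second factor. -/
theorem AutPair.twist_mul_left (p q r : AutPair k H) (h : H) :
    (p * q).twist r h = q.twist r (p.twist (q * r) h) := by
  change r.α.symm (q.β (q.α.symm (p.β (q.α (r.α h))))) =
    r.α.symm (q.β (r.α (r.α.symm (q.α.symm (p.β (q.α (r.α h)))))))
  simp

theorem AutPair.α_twist_mul_right (p q r : AutPair k H) (h : H) :
    r.α (p.twist (q * r) h) = p.twist q (r.α h) :=
  r.α.apply_symm_apply _

theorem opMul_assoc {V W U : Type*} [AddCommGroup V] [Module k V] [AddCommGroup W]
    [Module k W] [AddCommGroup U] [Module k U] (s : V ⊗[k] H) (t : W ⊗[k] H) (r : U ⊗[k] H) :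
    (TensorProduct.assoc k V W U).toLinearMap.rTensor H
      (opMul k (V ⊗[k] W) U H (opMul k V W H (s ⊗ₜ t) ⊗ₜ r)) =
    opMul k V (W ⊗[k] U) H (s ⊗ₜ opMul k W U H (t ⊗ₜ r)) := by
  induction s with
  | zero => simp
  | add s s' hs hs' => simp only [map_add, TensorProduct.add_tmul, hs, hs']
  | tmul v x =>
    induction t with
    | zero => simp
    | add t t' ht ht' => simp only [map_add, TensorProduct.tmul_add, TensorProduct.add_tmul, ht, ht']
    | tmul w y =>
      induction r with
      | zero => simp
      | add r r' hr hr' => simp only [map_add, TensorProduct.tmul_add, hr, hr']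
      | tmul u z => simp [mul_assoc]

/-- Once the automorphisms on each factor are matched, linearity is coassociativity of `H` and
colinearity is associativity of its product. -/
theorem isYDHom_assoc (p q r : AutPair k H) (M N P : ModData k H) :
    IsYDHom (ModData.tensor (p * q) r (ModData.tensor p q M N) P)
      (ModData.tensor p (q * r) M (ModData.tensor q r N P))
      (TensorProduct.assoc k M.V N.V P.V).toLinearMap := by
  constructor
  · intro h
    refine LinearMap.congr_fun (f := (TensorProduct.assoc k M.V N.V P.V).toLinearMap ∘ₗ
      tensorAct (p * q) r (ModData.tensor p q M N) P h)
      (g := tensorAct p (q * r) M (ModData.tensor q r N P) h ∘ₗ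
        (TensorProduct.assoc k M.V N.V P.V).toLinearMap)
      (TensorProduct.ext_threefold fun m n l => ?_)
    have hl : ∀ a b : H, TensorProduct.assoc k M.V N.V P.V
        (tensorAct p q M N (r.α a) (m ⊗ₜ n) ⊗ₜ P.ρ ((p * q).twist r b) l) =
        sw k a (fun a₁ a₂ => M.ρ (q.α (r.α a₁)) m ⊗ₜ (N.ρ (p.twist q (r.α a₂)) n ⊗ₜ
          P.ρ ((p * q).twist r b) l)) := by
      intro a b
      rw [tensorAct_tmul, sw_equiv]
      · exact map_sw ((TensorProduct.assoc k M.V N.V P.V).toLinearMap ∘ₗ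
          (TensorProduct.mk k _ P.V).flip (P.ρ ((p * q).twist r b) l)) a _
      · constructor <;> intros <;> simp [TensorProduct.add_tmul, TensorProduct.tmul_add,
          TensorProduct.smul_tmul']
    have hr : ∀ a b : H, M.ρ ((q * r).α a) m ⊗ₜ
        tensorAct q r N P (p.twist (q * r) b) (n ⊗ₜ[k] l) =
        sw k b (fun b₁ b₂ => M.ρ (q.α (r.α a)) m ⊗ₜ[k] (N.ρ (p.twist q (r.α b₁)) n ⊗ₜ[k]
          P.ρ ((p * q).twist r b₂) l)) := by
      intro a b
      rw [tensorAct_tmul, sw_equiv]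
      · simp only [AutPair.twist_mul_left, AutPair.α_twist_mul_right]
        exact map_sw (TensorProduct.mk k M.V _ (M.ρ ((q * r).α a) m)) b _
      · constructor <;> intros <;> simp [TensorProduct.add_tmul, TensorProduct.tmul_add,
          TensorProduct.smul_tmul']
    refine ((congrArg (TensorProduct.assoc k M.V N.V P.V) (tensorAct_tmul _ _ _ _ _ _ _)).trans
      ((map_sw (TensorProduct.assoc k M.V N.V P.V).toLinearMap _ _).trans (sw_congr hl))).trans (Eq.trans ?_
      ((tensorAct_tmul p (q * r) M (ModData.tensor q r N P) h m (n ⊗ₜ l)).trans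
        (sw_congr hr)).symm)
    refine sw_assoc (f := fun a b c => M.ρ (q.α (r.α a)) m ⊗ₜ[k]
      (N.ρ (p.twist q (r.α b)) n ⊗ₜ[k] P.ρ ((p * q).twist r c) l)) ?_ h
    refine ⟨?_, ?_, fun a => ⟨?_, ?_, ?_, ?_⟩⟩ <;> intros <;>
      simp [TensorProduct.add_tmul, TensorProduct.tmul_add, ← TensorProduct.smul_tmul']
  · refine LinearMap.congr_fun (f := (TensorProduct.assoc k M.V N.V P.V).toLinearMap.rTensor H ∘ₗ
      tensorCoact (ModData.tensor p q M N) P)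
      (g := tensorCoact M (ModData.tensor q r N P) ∘ₗ
        (TensorProduct.assoc k M.V N.V P.V).toLinearMap)
      (TensorProduct.ext_threefold fun m n l => ?_)
    exact opMul_assoc _ _ _

theorem isYDHom_lid (p : AutPair k H) (M : ModData k H) :
    IsYDHom (ModData.tensor 1 p (ModData.unit k H) M) M
      (TensorProduct.lid k M.V).toLinearMap := by
  constructor
  · intro h
    refine LinearMap.congr_fun (f := (TensorProduct.lid k M.V).toLinearMap ∘ₗ
      tensorAct 1 p (ModData.unit k H) M h)
      (g := M.ρ h ∘ₗ (TensorProduct.lid k M.V).toLinearMap)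
      (TensorProduct.ext' fun (c : k) m => ?_)
    refine (congrArg (TensorProduct.lid k M.V) (tensorAct_tmul _ _ _ _ _ _ _)).trans
      ((map_sw (TensorProduct.lid k M.V).toLinearMap _ _).trans ?_)
    have hl : ∀ a b : H, TensorProduct.lid k M.V
        (unitAct k H (p.α a) c ⊗ₜ M.ρ ((1 : AutPair k H).twist p b) m) =
        Coalgebra.counit (R := k) a • c • M.ρ b m := by
      intro a b
      have : (1 : AutPair k H).twist p b = b := p.α.symm_apply_apply b
      rw [unitAct_apply, TensorProduct.lid_tmul, this, smul_assoc]
      congr 1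
      exact CoalgHomClass.counit_comp_apply p.α a
    refine (sw_congr hl).trans ?_
    refine (sw_counit_left (c • LinearMap.applyₗ m ∘ₗ M.ρ.toLinearMap) h).trans ?_
    exact ((M.ρ h).map_smul c m).symm
  · refine LinearMap.congr_fun (f := (TensorProduct.lid k M.V).toLinearMap.rTensor H ∘ₗ
      tensorCoact (ModData.unit k H) M)
      (g := M.δ ∘ₗ (TensorProduct.lid k M.V).toLinearMap)
      (TensorProduct.ext' fun (c : k) m => ?_)
    have : ∀ t : M.V ⊗[k] H, (TensorProduct.lid k M.V).toLinearMap.rTensor H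
        (opMul k k M.V H ((c ⊗ₜ 1) ⊗ₜ t)) = c • t := by
      intro t
      induction t with
      | zero => simp
      | add t t' ht ht' => simp only [map_add, TensorProduct.tmul_add, ht, ht', smul_add]
      | tmul w y => simp [TensorProduct.smul_tmul']
    exact (this (M.δ m)).trans (M.δ.map_smul c m).symm

theorem isYDHom_rid (p : AutPair k H) (M : ModData k H) :
    IsYDHom (ModData.tensor p 1 M (ModData.unit k H)) M
      (TensorProduct.rid k M.V).toLinearMap := by
  constructor
  · intro h
    refine LinearMap.congr_fun (f := (TensorProduct.rid k M.V).toLinearMap ∘ₗ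
      tensorAct p 1 M (ModData.unit k H) h)
      (g := M.ρ h ∘ₗ (TensorProduct.rid k M.V).toLinearMap)
      (TensorProduct.ext' fun m (c : k) => ?_)
    refine (congrArg (TensorProduct.rid k M.V) (tensorAct_tmul _ _ _ _ _ _ _)).trans
      ((map_sw (TensorProduct.rid k M.V).toLinearMap _ _).trans ?_)
    have hl : ∀ a b : H, TensorProduct.rid k M.V
        (M.ρ ((1 : AutPair k H).α a) m ⊗ₜ unitAct k H (p.twist 1 b) c) =
        Coalgebra.counit (R := k) b • c • M.ρ a m := by
      intro a b
      have : (1 : AutPair k H).α a = a := rfl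
      rw [unitAct_apply, TensorProduct.rid_tmul, this, smul_assoc]
      congr 1
      exact CoalgHomClass.counit_comp_apply (p.twist 1) b
    refine (sw_congr hl).trans ?_
    refine (sw_counit_right (c • LinearMap.applyₗ m ∘ₗ M.ρ.toLinearMap) h).trans ?_
    exact ((M.ρ h).map_smul c m).symm
  · refine LinearMap.congr_fun (f := (TensorProduct.rid k M.V).toLinearMap.rTensor H ∘ₗ
      tensorCoact M (ModData.unit k H))
      (g := M.δ ∘ₗ (TensorProduct.rid k M.V).toLinearMap)
      (TensorProduct.ext' fun m (c : k) => ?_)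
    have : ∀ t : M.V ⊗[k] H, (TensorProduct.rid k M.V).toLinearMap.rTensor H
        (opMul k M.V k H (t ⊗ₜ (c ⊗ₜ 1))) = c • t := by
      intro t
      induction t with
      | zero => simp
      | add t t' ht ht' => simp only [map_add, TensorProduct.add_tmul, ht, ht', smul_add]
      | tmul w y => simp [TensorProduct.smul_tmul']
    exact (this (M.δ m)).trans (M.δ.map_smul c m).symm

end Tensor

/-! ### The monoidal category -/

section Monoidal

variable (k H : Type u) [Field k] [Ring H] [HopfAlgebra k H] [BijectiveAntipode k H]

scoped instance monoidalStruct : MonoidalCategoryStruct (Σ p : AutPair k H, YDMod k H p) where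
  tensorObj X Y := ⟨X.1 * Y.1, X.2.tensor Y.2⟩
  whiskerLeft X {_ _} f := mkHom (congrArg (X.1 * ·) (TCat.deg_eq_of_hom f))
    (TensorProduct.map LinearMap.id (lin f))
    (IsYDHom.tensor rfl (TCat.deg_eq_of_hom f) (isYDHom_lin (𝟙 X)) (isYDHom_lin f))
  whiskerRight {_ _} f Z := mkHom (congrArg (· * Z.1) (TCat.deg_eq_of_hom f))
    (TensorProduct.map (lin f) LinearMap.id)
    (IsYDHom.tensor (TCat.deg_eq_of_hom f) rfl (isYDHom_lin f) (isYDHom_lin (𝟙 Z)))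
  tensorHom {_ _ _ _} f g :=
    mkHom (congrArg₂ (· * ·) (TCat.deg_eq_of_hom f) (TCat.deg_eq_of_hom g))
      (TensorProduct.map (lin f) (lin g))
      (IsYDHom.tensor (TCat.deg_eq_of_hom f) (TCat.deg_eq_of_hom g) (isYDHom_lin f)
        (isYDHom_lin g))
  tensorUnit := ⟨1, YDMod.unit k H⟩
  associator X Y Z := mkIso (mul_assoc _ _ _) (TensorProduct.assoc k X.2.V Y.2.V Z.2.V)
    (isYDHom_assoc _ _ _ _ _ _)
  leftUnitor X := mkIso (one_mul _) (TensorProduct.lid k X.2.V) (isYDHom_lid _ _)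
  rightUnitor X := mkIso (mul_one _) (TensorProduct.rid k X.2.V) (isYDHom_rid _ _)

/-- The forgetful functor to vector spaces preserves all the monoidal structure strictly. -/
def inducingData : Monoidal.InducingFunctorData (forget k H) where
  μIso X Y := Iso.refl _
  εIso := Iso.refl _
  whiskerLeft_eq X Y Z f := (forget_map_mkHom _ _ _).trans rfl
  whiskerRight_eq f Z := (forget_map_mkHom _ _ _).trans rfl
  tensorHom_eq f g := (forget_map_mkHom _ _ _).trans rfl
  associator_eq X Y Z := (forget_map_mkHom _ _ _).trans <| by
    ext1
    exact TensorProduct.ext_threefold fun _ _ _ => rfl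
  leftUnitor_eq X := (forget_map_mkHom _ _ _).trans <| by
    ext1
    exact TensorProduct.ext' fun _ _ => rfl
  rightUnitor_eq X := (forget_map_mkHom (X := X ⊗ 𝟙_ _) (Y := X) (mul_one X.1) _
    (isYDHom_rid X.1 X.2.toModData)).trans <| by
    ext1
    exact TensorProduct.ext' fun _ _ => rfl

-- Pentagon, triangle and naturality hold because they hold for vector spaces and the forgetful
-- functor is faithful.
scoped instance monoidal : MonoidalCategory (Σ p : AutPair k H, YDMod k H p) :=
  Monoidal.induced (forget k H) (inducingData k H)

theorem forget_isStrictTensor : TCat.IsStrictTensor (forget k H) :=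
  ⟨Monoidal.fromInducedMonoidal (forget k H) (inducingData k H), ⟨rfl, rfl⟩,
    fun X Y => ⟨rfl, by
      change 𝟙 ((forget k H).obj X ⊗ (forget k H).obj Y) = _
      rfl⟩⟩

end Monoidal

/-! ### Comparing morphisms through their linear maps -/

section Lies

variable {k H : Type u} [Field k] [Ring H] [HopfAlgebra k H] [BijectiveAntipode k H]
  {W X Y Z : Σ p : AutPair k H, YDMod k H p} {A B C D : ModuleCat.{u} k}

/-- The morphism `f` of `YD(H)` has the underlying linear map `a`. -/
def Lies (f : X ⟶ Y) (a : A ⟶ B) : Prop :=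
  Arrow.mk ((forget k H).map f) = Arrow.mk a

theorem lies_map (f : X ⟶ Y) : Lies f ((forget k H).map f) := rfl

/-- Faithfulness, in a form that tolerates equal but not syntactically identical sources and
targets. Every later coherence equation is closed this way. -/
theorem Lies.unique {f g : X ⟶ Y} {a : A ⟶ B} (hf : Lies f a) (hg : Lies g a) : f = g :=
  (forget k H).map_injective (Arrow.mk_injective _ _ (hf.trans hg.symm))

theorem Lies.comp {f : X ⟶ Y} {g : Y ⟶ Z} {a : A ⟶ B} {b : B ⟶ C} (hf : Lies f a)
    (hg : Lies g b) : Lies (f ≫ g) (a ≫ b) := by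
  have hA : (forget k H).obj X = A := congrArg Comma.left hf
  have hB : (forget k H).obj Y = B := congrArg Comma.right hf
  have hC : (forget k H).obj Z = C := congrArg Comma.right hg
  subst hA hB hC
  obtain rfl := Arrow.mk_injective _ _ hf
  obtain rfl := Arrow.mk_injective _ _ hg
  exact congrArg Arrow.mk ((forget k H).map_comp f g)

theorem lies_id (hX : (forget k H).obj X = A) : Lies (𝟙 X) (𝟙 A) := by
  subst hX
  exact congrArg Arrow.mk ((forget k H).map_id X)

/-- Transport along an equality of objects is invisible on vector spaces; this disposes of all
`eqToHom`s in the axioms. -/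
theorem lies_eqToHom (h : X = Y) (hX : (forget k H).obj X = A) : Lies (eqToHom h) (𝟙 A) := by
  subst h
  exact lies_id hX

theorem lies_mkHom (h : X.1 = Y.1) (f : X.2.V →ₗ[k] Y.2.V)
    (hf : IsYDHom X.2.toModData Y.2.toModData f) : Lies (mkHom h f hf) (ModuleCat.ofHom f) :=
  congrArg Arrow.mk (forget_map_mkHom h f hf)

theorem Lies.tensorHom {f : X ⟶ Y} {g : W ⟶ Z} {a : A ⟶ B} {b : C ⟶ D} (hf : Lies f a)
    (hg : Lies g b) : Lies (f ⊗ₘ g) (a ⊗ₘ b) := by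
  have hA : (forget k H).obj X = A := congrArg Comma.left hf
  have hB : (forget k H).obj Y = B := congrArg Comma.right hf
  have hC : (forget k H).obj W = C := congrArg Comma.left hg
  have hD : (forget k H).obj Z = D := congrArg Comma.right hg
  subst hA hB hC hD
  obtain rfl := Arrow.mk_injective _ _ hf
  obtain rfl := Arrow.mk_injective _ _ hg
  exact lies_mkHom _ _ _

theorem Lies.whiskerRight {f : X ⟶ Y} {a : A ⟶ B} (hf : Lies f a)
    (hZ : (forget k H).obj Z = C) : Lies (f ▷ Z) (a ▷ C) := by
  rw [← tensorHom_id, ← tensorHom_id]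
  exact hf.tensorHom (lies_id hZ)

theorem Lies.whiskerLeft {f : X ⟶ Y} {a : A ⟶ B} (hZ : (forget k H).obj Z = C)
    (hf : Lies f a) : Lies (Z ◁ f) (C ◁ a) := by
  rw [← id_tensorHom, ← id_tensorHom]
  exact (lies_id hZ).tensorHom hf

theorem lies_associator_hom (hX : (forget k H).obj X = A) (hY : (forget k H).obj Y = B)
    (hZ : (forget k H).obj Z = C) : Lies (α_ X Y Z).hom (α_ A B C).hom := by
  subst hX hY hZ
  exact lies_mkHom _ _ _

theorem lies_associator_inv (hX : (forget k H).obj X = A) (hY : (forget k H).obj Y = B)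
    (hZ : (forget k H).obj Z = C) : Lies (α_ X Y Z).inv (α_ A B C).inv := by
  subst hX hY hZ
  exact lies_mkHom _ _ _

theorem lies_leftUnitor_hom (hX : (forget k H).obj X = A) : Lies (λ_ X).hom (λ_ A).hom := by
  subst hX
  exact lies_mkHom _ _ _

theorem lies_rightUnitor_hom (hX : (forget k H).obj X = A) : Lies (ρ_ X).hom (ρ_ A).hom := by
  subst hX
  exact lies_mkHom (X := X ⊗ 𝟙_ _) (Y := X) (mul_one X.1) _ (isYDHom_rid X.1 X.2.toModData)

/-- Functors that leave linear maps unchanged are determined by their objects, since heterogeneous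
equality on morphisms follows from `Lies.unique`. -/
theorem functor_ext {F G : (Σ p : AutPair k H, YDMod k H p) ⥤ (Σ p : AutPair k H, YDMod k H p)}
    (hobj : ∀ X, F.obj X = G.obj X)
    (hF : ∀ {X Y : Σ p : AutPair k H, YDMod k H p} (f : X ⟶ Y),
      Lies (F.map f) ((forget k H).map f))
    (hG : ∀ {X Y : Σ p : AutPair k H, YDMod k H p} (f : X ⟶ Y),
      Lies (G.map f) ((forget k H).map f)) : F = G := by
  have key : ∀ {X X' Y Y' : Σ p : AutPair k H, YDMod k H p} (_ : X = X') (_ : Y = Y')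
      {f : X ⟶ Y} {f' : X' ⟶ Y'} {A B : ModuleCat.{u} k} {a : A ⟶ B}, Lies f a → Lies f' a →
      HEq f f' := by
    intro X X' Y Y' hX hY f f' A B a hf hf'
    subst hX hY
    exact heq_of_eq (hf.unique hf')
  exact CategoryTheory.Functor.hext hobj fun X Y f => key (hobj X) (hobj Y) (hF f) (hG f)

end Lies

/-! ### Formulas for composite pairs of automorphisms -/

section Aut

variable {k H : Type u} [Field k] [Ring H] [HopfAlgebra k H] (p q : AutPair k H) (h : H)

namespace AutPair

/-- These formulas expand composite pairs into words in the given automorphisms and their inverses,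
in which `simp` cancels adjacent inverse letters. -/
theorem inv_α_apply : p⁻¹.α h = p.α.symm h := rfl

theorem inv_β_apply : p⁻¹.β h = p.α (p.β.symm (p.α.symm h)) := rfl

theorem inv_α_symm_apply : p⁻¹.α.symm h = p.α h := rfl

theorem mul_α_symm_apply : (p * q).α.symm h = q.α.symm (p.α.symm h) := rfl

theorem mul_β_symm_apply :
    (p * q).β.symm h = q.α.symm (p.β.symm (q.α (q.β.symm h))) := rfl

theorem twist_apply : p.twist q h = q.α.symm (p.β (q.α h)) := rfl

theorem actTwist_apply : p.actTwist q h = q.α.symm (p.β (q.α (p.α.symm h))) := rfl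

theorem coactTwist_apply : p.coactTwist h = p.α (p.β.symm h) := rfl

end AutPair

end Aut

/-! ### Conjugation laws as equalities of objects -/

section ConjObj

variable {k H : Type u} [Field k] [Ring H] [HopfAlgebra k H]

/-- Keeping `V` fixed lets the structures be compared without transport. -/
theorem modData_eq {V : Type u} [AddCommGroup V] [Module k V] {ρ ρ' : H →ₐ[k] Module.End k V}
    {δ δ' : V →ₗ[k] V ⊗[k] H} (hρ : ρ = ρ') (hδ : δ = δ') :
    (⟨V, ρ, δ⟩ : ModData k H) = ⟨V, ρ', δ'⟩ := by
  subst hρ hδ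
  rfl

theorem coactTwistMap_eq_of_forall {V : Type*} [AddCommGroup V] [Module k V] {p : AutPair k H}
    {f : V ⊗[k] H →ₗ[k] V ⊗[k] H} (hf : ∀ v x, f (v ⊗ₜ x) = v ⊗ₜ p.coactTwist x) :
    coactTwistMap p V = f :=
  TensorProduct.ext' fun v x => (hf v x).symm

theorem conj_one_eq (q : AutPair k H) (N : ModData k H) : ModData.conj 1 q N = N := by
  refine modData_eq (V := N.V) (ρ := conjAct 1 q N) (ρ' := N.ρ) (δ := conjCoact 1 N)
    (δ' := N.δ) (AlgHom.ext fun h => ?_) ?_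
  · exact congrArg N.ρ (q.α.symm_apply_apply h)
  · exact congrArg (· ∘ₗ N.δ) (coactTwistMap_eq_of_forall (f := LinearMap.id) fun v x => rfl)

/-- The coaction twist `(α, β) ↦ αβ⁻¹` is multiplicative in the pair, and the action twist satisfies
the cocycle identity for conjugation of degrees. -/
theorem conj_mul_eq (p p' q : AutPair k H) (N : ModData k H) :
    ModData.conj (p * p') q N =
      ModData.conj p (p' * q * p'⁻¹) (ModData.conj p' q N) := by
  refine modData_eq (V := N.V) (ρ := conjAct (p * p') q N)
    (ρ' := conjAct p (p' * q * p'⁻¹) (ModData.conj p' q N)) (δ := conjCoact (p * p') N)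
    (δ' := conjCoact p (ModData.conj p' q N)) (AlgHom.ext fun h => ?_) ?_
  · change N.ρ ((p * p').actTwist q h) = N.ρ (p'.actTwist q (p.actTwist (p' * q * p'⁻¹) h))
    congr 1
    simp [AutPair.actTwist_apply, AutPair.mul_α_apply, AutPair.mul_β_apply, AutPair.inv_α_apply,
      AutPair.mul_α_symm_apply, AutPair.inv_α_symm_apply]
  · refine congrArg (· ∘ₗ N.δ) (coactTwistMap_eq_of_forall
      (f := coactTwistMap p N.V ∘ₗ coactTwistMap p' N.V) fun v x => ?_)
    simp [AutPair.coactTwist_apply, AutPair.mul_α_apply, AutPair.mul_β_symm_apply]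

theorem conj_unit_eq (p : AutPair k H) :
    ModData.conj p 1 (ModData.unit k H) = ModData.unit k H := by
  refine modData_eq (V := k) (ρ := conjAct p 1 (ModData.unit k H)) (ρ' := unitAct k H)
    (δ := conjCoact p (ModData.unit k H)) (δ' := (TensorProduct.mk k k H).flip 1)
    (AlgHom.ext fun h => LinearMap.ext fun c => ?_) (LinearMap.ext fun c => ?_)
  · exact congrArg (· • c) (CoalgHomClass.counit_comp_apply (p.actTwist 1) h)
  · exact congrArg (c ⊗ₜ[k] ·) (map_one p.coactTwist)

theorem opMul_coactTwistMap (p : AutPair k H) {V W : Type*} [AddCommGroup V] [Module k V]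
    [AddCommGroup W] [Module k W] (s : V ⊗[k] H) (t : W ⊗[k] H) :
    coactTwistMap p (V ⊗[k] W) (opMul k V W H (s ⊗ₜ t)) =
      opMul k V W H (coactTwistMap p V s ⊗ₜ coactTwistMap p W t) := by
  induction s with
  | zero => simp
  | add s s' hs hs' => simp only [map_add, TensorProduct.add_tmul, hs, hs']
  | tmul v x =>
    induction t with
    | zero => simp
    | add t t' ht ht' => simp only [map_add, TensorProduct.tmul_add, ht, ht']
    | tmul w y => simp

theorem tensorCoact_mk {V W : Type u} [AddCommGroup V] [Module k V] [AddCommGroup W]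
    [Module k W] (ρ : H →ₐ[k] Module.End k V) (δ : V →ₗ[k] V ⊗[k] H)
    (ρ' : H →ₐ[k] Module.End k W) (δ' : W →ₗ[k] W ⊗[k] H) :
    tensorCoact (k := k) (H := H) ⟨V, ρ, δ⟩ ⟨W, ρ', δ'⟩ =
      opMul k V W H ∘ₗ TensorProduct.map δ δ' := rfl

/-- For the action, the words of automorphisms on each factor agree; for the coaction, `αβ⁻¹`
preserves the product `n₍₁₎ m₍₁₎`. -/
theorem conj_tensor_eq (p q r : AutPair k H) (M N : ModData k H) :
    ModData.conj p (q * r) (ModData.tensor q r M N) =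
      ModData.tensor (p * q * p⁻¹) (p * r * p⁻¹) (ModData.conj p q M) (ModData.conj p r N) := by
  refine modData_eq (V := M.V ⊗[k] N.V) (ρ := conjAct p (q * r) (ModData.tensor q r M N))
    (ρ' := tensorAct (p * q * p⁻¹) (p * r * p⁻¹) (ModData.conj p q M) (ModData.conj p r N))
    (δ := conjCoact p (ModData.tensor q r M N))
    (δ' := tensorCoact (ModData.conj p q M) (ModData.conj p r N))
    (AlgHom.ext fun h => TensorProduct.ext' fun m n => ?_) (TensorProduct.ext' fun m n => ?_)
  · refine (tensorAct_tmul q r M N (p.actTwist (q * r) h) m n).trans (Eq.trans ?_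
      (tensorAct_tmul (p * q * p⁻¹) (p * r * p⁻¹) (ModData.conj p q M) (ModData.conj p r N)
        h m n).symm)
    rw [sw_equiv]
    · refine sw_congr fun a b => ?_
      change M.ρ _ m ⊗ₜ[k] N.ρ _ n = M.ρ (p.actTwist q ((p * r * p⁻¹).α a)) m ⊗ₜ[k]
        N.ρ (p.actTwist r ((p * q * p⁻¹).twist (p * r * p⁻¹) b)) n
      simp [AutPair.actTwist_apply, AutPair.twist_apply, AutPair.mul_α_apply,
        AutPair.mul_β_apply, AutPair.inv_α_apply, AutPair.inv_β_apply, AutPair.mul_α_symm_apply,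
        AutPair.inv_α_symm_apply]
    · constructor <;> intros <;> simp [TensorProduct.add_tmul, TensorProduct.tmul_add,
        TensorProduct.smul_tmul']
  · have h1 : conjCoact p (ModData.tensor q r M N) =
        coactTwistMap p (M.V ⊗[k] N.V) ∘ₗ tensorCoact M N := rfl
    have h2 : tensorCoact (ModData.conj p q M) (ModData.conj p r N) =
        opMul k M.V N.V H ∘ₗ TensorProduct.map (conjCoact p M) (conjCoact p N) :=
      tensorCoact_mk ..
    refine (LinearMap.congr_fun h1 (m ⊗ₜ n)).trans
      (Eq.trans ?_ (LinearMap.congr_fun h2 (m ⊗ₜ n)).symm)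
    exact opMul_coactTwistMap p (M.δ m) (N.δ n)

theorem IsYDHom.conj {p q q' : AutPair k H} (hq : q = q') {M N : ModData k H}
    {f : M.V →ₗ[k] N.V} (hf : IsYDHom M N f) :
    IsYDHom (ModData.conj p q M) (ModData.conj p q' N) f := by
  subst hq
  refine ⟨fun h v => hf.linear _ v, fun (v : M.V) => ?_⟩
  have h : ∀ t : M.V ⊗[k] H,
      f.rTensor H (coactTwistMap p M.V t) = coactTwistMap p N.V (f.rTensor H t) := by
    intro t
    induction t with
    | zero => simp
    | add t t' ht ht' => simp only [map_add, ht, ht']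
    | tmul v x => simp
  exact (h (M.δ v)).trans (congrArg (coactTwistMap p N.V) (hf.colinear v))

end ConjObj

/-! ### The conjugation functors and the T-category -/

section ConjFunctor

variable {k H : Type u} [Field k] [Ring H] [HopfAlgebra k H] [BijectiveAntipode k H]

/-- The conjugate of an object of `YD(H)`. -/
def conjObj (p : AutPair k H) (X : Σ q : AutPair k H, YDMod k H q) :
    Σ q : AutPair k H, YDMod k H q :=
  ⟨p * X.1 * p⁻¹, X.2.conj p⟩

/-- The conjugate of a morphism of `YD(H)`. -/
def conjMap (p : AutPair k H) {X Y : Σ q : AutPair k H, YDMod k H q} (f : X ⟶ Y) :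
    conjObj p X ⟶ conjObj p Y :=
  mkHom (congrArg (p * · * p⁻¹) (TCat.deg_eq_of_hom f)) (lin (X := X) (Y := Y) f)
    (IsYDHom.conj (TCat.deg_eq_of_hom f) (isYDHom_lin f))

theorem Lies.conjMap (p : AutPair k H) {X Y : Σ q : AutPair k H, YDMod k H q} {f : X ⟶ Y}
    {A B : ModuleCat.{u} k} {a : A ⟶ B} (hf : Lies f a) : Lies (conjMap p f) a :=
  (lies_mkHom _ _ _).trans hf

/-- The conjugation functor `φ_p`. -/
def conjFunctor (p : AutPair k H) :
    (Σ q : AutPair k H, YDMod k H q) ⥤ (Σ q : AutPair k H, YDMod k H q) where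
  obj X := conjObj p X
  map f := conjMap p f
  map_id _ := (Lies.conjMap p (lies_id rfl)).unique (lies_id rfl)
  map_comp f g := (Lies.conjMap p ((lies_map f).comp (lies_map g))).unique
    ((Lies.conjMap p (lies_map f)).comp (Lies.conjMap p (lies_map g)))

theorem lies_conjFunctor_map (p : AutPair k H) {X Y : Σ q : AutPair k H, YDMod k H q}
    {f : X ⟶ Y} {A B : ModuleCat.{u} k} {a : A ⟶ B} (hf : Lies f a) :
    Lies ((conjFunctor p).map f) a :=
  hf.conjMap p

theorem conjFunctor_comp_forget (p : AutPair k H) :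
    conjFunctor p ⋙ forget k H = forget k H :=
  CategoryTheory.Functor.ext (fun _ => rfl) fun _ _ f =>
    Arrow.mk_injective _ _ ((lies_map f).conjMap p)

theorem conjFunctor_one : conjFunctor (1 : AutPair k H) = 𝟭 _ :=
  functor_ext (fun X => obj_ext (show 1 * X.1 * 1⁻¹ = X.1 by simp)
    (conj_one_eq X.1 X.2.toModData)) (fun f => (lies_map f).conjMap 1) fun f => lies_map f

theorem conjFunctor_mul (p q : AutPair k H) :
    conjFunctor (p * q) = conjFunctor q ⋙ conjFunctor p :=
  functor_ext (fun X => obj_ext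
    (show p * q * X.1 * (p * q)⁻¹ = p * (q * X.1 * q⁻¹) * p⁻¹ by group)
    (conj_mul_eq p q X.1 X.2.toModData)) (fun f => (lies_map f).conjMap (p * q))
    fun f => ((lies_map f).conjMap q).conjMap p

theorem conjFunctor_unit (p : AutPair k H) :
    𝟙_ (Σ q : AutPair k H, YDMod k H q) = (conjFunctor p).obj (𝟙_ _) :=
  (obj_ext (show p * 1 * p⁻¹ = 1 by simp) (conj_unit_eq p)).symm

theorem conjFunctor_tensor (p : AutPair k H) (X Y : Σ q : AutPair k H, YDMod k H q) :
    (conjFunctor p).obj X ⊗ (conjFunctor p).obj Y = (conjFunctor p).obj (X ⊗ Y) :=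
  (obj_ext (show p * (X.1 * Y.1) * p⁻¹ = p * X.1 * p⁻¹ * (p * Y.1 * p⁻¹) by group)
    (conj_tensor_eq p X.1 Y.1 X.2.toModData Y.2.toModData)).symm

theorem forget_obj_conjFunctor (p : AutPair k H) (X : Σ q : AutPair k H, YDMod k H q) :
    (forget k H).obj ((conjFunctor p).obj X) = (forget k H).obj X := rfl

theorem forget_obj_tensor (X Y : Σ q : AutPair k H, YDMod k H q) :
    (forget k H).obj (X ⊗ Y) = (forget k H).obj X ⊗ (forget k H).obj Y := rfl

theorem forget_obj_unit :
    (forget k H).obj (𝟙_ (Σ q : AutPair k H, YDMod k H q)) = 𝟙_ (ModuleCat.{u} k) := rfl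

theorem lies_conjFunctor_tensor (p : AutPair k H) (X Y : Σ q : AutPair k H, YDMod k H q)
    {A B : ModuleCat.{u} k} (hX : (forget k H).obj X = A) (hY : (forget k H).obj Y = B) :
    Lies (eqToHom (conjFunctor_tensor p X Y)) (𝟙 (A ⊗ B)) := by
  subst hX hY
  exact lies_eqToHom _ (forget_obj_tensor ((conjFunctor p).obj X) ((conjFunctor p).obj Y))

theorem lies_conjFunctor_unit (p : AutPair k H) :
    Lies (eqToHom (conjFunctor_unit p)) (𝟙 (𝟙_ (ModuleCat.{u} k))) :=
  lies_eqToHom _ forget_obj_unit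

section

variable (p : AutPair k H) (X Y Z : Σ q : AutPair k H, YDMod k H q)

/-- Here and in the next four lemmas, the `eqToHom`s lie over identities and conjugation keeps
linear maps, so both sides lie over the same map of vector spaces. -/
theorem conjFunctor_natural_left {X Y : Σ q : AutPair k H, YDMod k H q} (f : X ⟶ Y)
    (Z : Σ q : AutPair k H, YDMod k H q) :
    (conjFunctor p).map f ▷ (conjFunctor p).obj Z ≫ eqToHom (conjFunctor_tensor p Y Z) =
      eqToHom (conjFunctor_tensor p X Z) ≫ (conjFunctor p).map (f ▷ Z) := by
  have h₁ := ((lies_conjFunctor_map p (lies_map f)).whiskerRight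
    (forget_obj_conjFunctor p Z)).comp (lies_conjFunctor_tensor p Y Z rfl rfl)
  have h₂ := (lies_conjFunctor_tensor p X Z rfl rfl).comp
    (lies_conjFunctor_map p ((lies_map f).whiskerRight (Z := Z) rfl))
  rw [Category.comp_id] at h₁
  rw [Category.id_comp] at h₂
  exact h₁.unique h₂

theorem conjFunctor_natural_right {X Y : Σ q : AutPair k H, YDMod k H q}
    (Z : Σ q : AutPair k H, YDMod k H q) (f : X ⟶ Y) :
    (conjFunctor p).obj Z ◁ (conjFunctor p).map f ≫ eqToHom (conjFunctor_tensor p Z Y) =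
      eqToHom (conjFunctor_tensor p Z X) ≫ (conjFunctor p).map (Z ◁ f) := by
  have h₁ := ((lies_conjFunctor_map p (lies_map f)).whiskerLeft
    (forget_obj_conjFunctor p Z)).comp (lies_conjFunctor_tensor p Z Y rfl rfl)
  have h₂ := (lies_conjFunctor_tensor p Z X rfl rfl).comp
    (lies_conjFunctor_map p ((lies_map f).whiskerLeft (Z := Z) rfl))
  rw [Category.comp_id] at h₁
  rw [Category.id_comp] at h₂
  exact h₁.unique h₂

theorem conjFunctor_associativity :
    eqToHom (conjFunctor_tensor p X Y) ▷ (conjFunctor p).obj Z ≫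
        eqToHom (conjFunctor_tensor p (X ⊗ Y) Z) ≫ (conjFunctor p).map (α_ X Y Z).hom =
      (α_ ((conjFunctor p).obj X) ((conjFunctor p).obj Y) ((conjFunctor p).obj Z)).hom ≫
        (conjFunctor p).obj X ◁ eqToHom (conjFunctor_tensor p Y Z) ≫
          eqToHom (conjFunctor_tensor p X (Y ⊗ Z)) := by
  have h₁ := ((lies_conjFunctor_tensor p X Y rfl rfl).whiskerRight
    (forget_obj_conjFunctor p Z)).comp
      ((lies_conjFunctor_tensor p (X ⊗ Y) Z (forget_obj_tensor X Y) rfl).comp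
        (lies_conjFunctor_map p (lies_associator_hom (X := X) (Y := Y) (Z := Z) rfl rfl rfl)))
  have h₂ := (lies_associator_hom (forget_obj_conjFunctor p X) (forget_obj_conjFunctor p Y)
    (forget_obj_conjFunctor p Z)).comp
      (((lies_conjFunctor_tensor p Y Z rfl rfl).whiskerLeft (forget_obj_conjFunctor p X)).comp
        (lies_conjFunctor_tensor p X (Y ⊗ Z) rfl (forget_obj_tensor Y Z)))
  rw [id_whiskerRight, Category.id_comp, Category.id_comp] at h₁
  rw [whiskerLeft_id, Category.comp_id, Category.comp_id] at h₂
  exact h₁.unique h₂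

theorem conjFunctor_left_unitality :
    (λ_ ((conjFunctor p).obj X)).hom =
      eqToHom (conjFunctor_unit p) ▷ (conjFunctor p).obj X ≫
        eqToHom (conjFunctor_tensor p (𝟙_ _) X) ≫ (conjFunctor p).map (λ_ X).hom := by
  have h₁ := lies_leftUnitor_hom (forget_obj_conjFunctor p X)
  have h₂ := ((lies_conjFunctor_unit p).whiskerRight (forget_obj_conjFunctor p X)).comp
    ((lies_conjFunctor_tensor p (𝟙_ _) X forget_obj_unit rfl).comp
      (lies_conjFunctor_map p (lies_leftUnitor_hom (X := X) rfl)))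
  rw [id_whiskerRight, Category.id_comp, Category.id_comp] at h₂
  exact h₁.unique h₂

theorem conjFunctor_right_unitality :
    (ρ_ ((conjFunctor p).obj X)).hom =
      (conjFunctor p).obj X ◁ eqToHom (conjFunctor_unit p) ≫
        eqToHom (conjFunctor_tensor p X (𝟙_ _)) ≫ (conjFunctor p).map (ρ_ X).hom := by
  have h₁ := lies_rightUnitor_hom (forget_obj_conjFunctor p X)
  have h₂ := ((lies_conjFunctor_unit p).whiskerLeft (forget_obj_conjFunctor p X)).comp
    ((lies_conjFunctor_tensor p X (𝟙_ _) rfl forget_obj_unit).comp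
      (lies_conjFunctor_map p (lies_rightUnitor_hom (X := X) rfl)))
  rw [whiskerLeft_id, Category.id_comp, Category.id_comp] at h₂
  exact h₁.unique h₂

end

/-- The conjugation functor is a strict tensor functor. -/
def conjFunctorCoreMonoidal (p : AutPair k H) : (conjFunctor p).CoreMonoidal where
  εIso := eqToIso (conjFunctor_unit p)
  μIso X Y := eqToIso (conjFunctor_tensor p X Y)
  μIso_hom_natural_left f Z := conjFunctor_natural_left p f Z
  μIso_hom_natural_right Z f := conjFunctor_natural_right p Z f
  associativity X Y Z := conjFunctor_associativity p X Y Z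
  left_unitality X := conjFunctor_left_unitality p X
  right_unitality X := conjFunctor_right_unitality p X

theorem conjFunctor_isStrictTensor (p : AutPair k H) : TCat.IsStrictTensor (conjFunctor p) :=
  ⟨(conjFunctorCoreMonoidal p).toMonoidal, ⟨conjFunctor_unit p, rfl⟩,
    fun X Y => ⟨conjFunctor_tensor p X Y, rfl⟩⟩

/-- The T-category `YD(H)`. -/
def tCategory (k H : Type u) [Field k] [Ring H] [HopfAlgebra k H] [BijectiveAntipode k H] :
    TCat.TCategory (AutPair k H) (YDMod k H) where
  deg_unit := rfl
  deg_tensor _ _ := rfl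
  conj := conjFunctor
  conj_one := conjFunctor_one
  conj_mul := conjFunctor_mul
  conj_strict := conjFunctor_isStrictTensor
  deg_conj _ _ := rfl

end ConjFunctor

/-! ### The braiding on vector spaces -/

section Braid

variable {k H : Type u} [Field k] [Ring H] [HopfAlgebra k H]
  {V W U : Type*} [AddCommGroup V] [Module k V] [AddCommGroup W] [Module k W]
  [AddCommGroup U] [Module k U]

theorem sweedler_add_fun {A B : Type*} [AddCommGroup A] [Module k A] [AddCommGroup B]
    [Module k B] (t : A ⊗[k] B) (f g : A → B → W) :
    sweedler t (fun a b => f a b + g a b) = sweedler t f + sweedler t g :=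
  Finset.sum_add_distrib

theorem sweedler_coassoc {δ : W →ₗ[k] W ⊗[k] H}
    (hδ : (Coalgebra.comul (R := k) (A := H)).lTensor W ∘ₗ δ =
      (TensorProduct.assoc k W H H).toLinearMap ∘ₗ δ.rTensor H ∘ₗ δ)
    {f : W → H → H → U} (hf : IsTrilin k f) (w : W) :
    sweedler (δ w) (fun w' x => sweedler (δ w') (fun w'' y => f w'' y x)) =
      sweedler (δ w) (fun w' x => sw k x (fun x₁ x₂ => f w' x₁ x₂)) :=
  sweedler_assoc hf δ _ (LinearMap.congr_fun hδ w).symm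

theorem sweedler_counit {δ : W →ₗ[k] W ⊗[k] H}
    (hδ : (TensorProduct.rid k W).toLinearMap ∘ₗ
      (Coalgebra.counit (R := k) (A := H)).lTensor W ∘ₗ δ = LinearMap.id)
    (g : W →ₗ[k] U) (w : W) :
    sweedler (δ w) (fun w' x => Coalgebra.counit (R := k) x • g w') = g w := by
  have h := congrArg g (LinearMap.congr_fun hδ w)
  refine Eq.trans ?_ h
  refine Eq.trans (sweedler_congr fun w' x => ?_) (apply_eq_sweedler (g ∘ₗ
    (TensorProduct.rid k W).toLinearMap ∘ₗ (Coalgebra.counit (R := k) (A := H)).lTensor W)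
    (δ w)).symm
  simp

/-- The map `w ⊗ x ↦ w ⊗ φ(x) · v`. -/
def evalAct (ρ : H →ₐ[k] Module.End k V) (φ : H →ₗ[k] H) (W : Type*) [AddCommGroup W]
    [Module k W] (v : V) : W ⊗[k] H →ₗ[k] W ⊗[k] V :=
  ((ρ.toLinearMap ∘ₗ φ).flip v).lTensor W

/-- The map `v ⊗ w ↦ w₍₀₎ ⊗ φ(w₍₁₎) · v`. -/
def braidGen (ρ : H →ₐ[k] Module.End k V) (φ : H →ₗ[k] H) (δ : W →ₗ[k] W ⊗[k] H) :
    V ⊗[k] W →ₗ[k] W ⊗[k] V :=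
  TensorProduct.lift (LinearMap.lcomp k (W ⊗[k] V) δ ∘ₗ LinearMap.lTensorHom W ∘ₗ
    (ρ.toLinearMap ∘ₗ φ).flip)

variable (ρ : H →ₐ[k] Module.End k V) (φ : H →ₗ[k] H)

@[simp]
theorem evalAct_tmul (v : V) (w : W) (x : H) :
    evalAct ρ φ W v (w ⊗ₜ x) = w ⊗ₜ ρ (φ x) v := rfl

theorem evalAct_eq_sweedler (v : V) (t : W ⊗[k] H) :
    evalAct ρ φ W v t = sweedler t (fun w x => w ⊗ₜ ρ (φ x) v) :=
  apply_eq_sweedler _ t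

theorem braidGen_tmul (δ : W →ₗ[k] W ⊗[k] H) (v : V) (w : W) :
    braidGen ρ φ δ (v ⊗ₜ w) = evalAct ρ φ W v (δ w) := rfl

/-- From `φ⁻¹(x φ(a)) = φ⁻¹(x) a`: acting on the first factor before braiding is a right
multiplication on the coaction leg, the shape in which a crossing relation applies. -/
theorem evalAct_act (φ : H ≃ₐc[k] H) (σ : H →ₐ[k] Module.End k W) (a : H) (v : V)
    (t : W ⊗[k] H) :
    evalAct ρ (φ.symm : H →ₗ[k] H) W (ρ a v) t =
      evalAct ρ (φ.symm : H →ₗ[k] H) W v (op σ 1 1 (φ a) t) := by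
  induction t with
  | zero => simp
  | add t t' ht ht' => simp only [map_add, ht, ht']
  | tmul w x =>
    have h : φ.symm (x * φ a) = φ.symm x * a := by rw [map_mul, φ.symm_apply_apply]
    have h' : ρ (φ.symm (x * φ a)) v = ρ (φ.symm x) (ρ a v) := by rw [h, map_mul]; rfl
    rw [op_tmul, map_one, one_mul]
    exact congrArg (w ⊗ₜ[k] ·) h'.symm

theorem evalAct_op (φ : H ≃ₐc[k] H) (σ : H →ₐ[k] Module.End k W) (a b : H) (v : V)
    (t : W ⊗[k] H) :
    evalAct ρ (φ : H →ₗ[k] H) W v (op σ a b 1 t) =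
      TensorProduct.map (σ a) (ρ (φ b)) (evalAct ρ (φ : H →ₗ[k] H) W v t) := by
  induction t with
  | zero => simp
  | add t t' ht ht' => simp only [map_add, ht, ht']
  | tmul w x => simp

theorem tensorAct_apply (p q : AutPair k H) (M N : ModData k H) (h : H) (t : M.V ⊗[k] N.V) :
    tensorAct p q M N h t =
      sw k h (fun a b => TensorProduct.map (M.ρ (q.α a)) (N.ρ (p.twist q b)) t) := by
  induction t with
  | zero => simp [sw, sweedler]
  | add t t' ht ht' => simp only [map_add, ht, ht', sw_add_fun]
  | tmul m n => exact tensorAct_tmul p q M N h m n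

/-- The automorphism through which `h` acts on `M` in the target of the braiding. -/
theorem AutPair.conj_twist (p q : AutPair k H) (h : H) :
    (p * q * p⁻¹).twist p h = p.β.symm (q.β (p.twist q h)) := by
  simp [AutPair.twist_apply, AutPair.mul_β_apply, AutPair.inv_α_apply,
    AutPair.inv_β_apply, AutPair.inv_α_symm_apply]

/-- The action of `γ(h₁)` on `m` becomes the factor `βγ(h₁) = γ(γ⁻¹βγ(h₁))` to the right of `n₍₁₎`.
The crossing relation of `N` at `γ⁻¹βγ(h)` trades it for an action on `n₍₀₎` and a factor on the
left, which `β⁻¹` turns into an action on `M`. -/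
theorem braidGen_linear {p q : AutPair k H} {M N : ModData k H} (hN : Crossed q N.ρ N.δ)
    (h : H) (t : M.V ⊗[k] N.V) :
    braidGen M.ρ (p.β.symm : H →ₗ[k] H) N.δ (tensorAct p q M N h t) =
      tensorAct (p * q * p⁻¹) p (ModData.conj p q N) M h
        (braidGen M.ρ (p.β.symm : H →ₗ[k] H) N.δ t) := by
  refine LinearMap.congr_fun (f := braidGen M.ρ (p.β.symm : H →ₗ[k] H) N.δ ∘ₗ tensorAct p q M N h)
    (g := tensorAct (p * q * p⁻¹) p (ModData.conj p q N) M h ∘ₗ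
      braidGen M.ρ (p.β.symm : H →ₗ[k] H) N.δ) (TensorProduct.ext' fun m n => ?_) t
  have hL : braidGen M.ρ (p.β.symm : H →ₗ[k] H) N.δ (tensorAct p q M N h (m ⊗ₜ n)) =
      sw k h (fun a b => evalAct M.ρ (p.β.symm : H →ₗ[k] H) N.V m
        (op N.ρ 1 1 (q.α (p.twist q a)) (N.δ (N.ρ (p.twist q b) n)))) := by
    rw [tensorAct_tmul, map_sw]
    refine sw_congr fun a b => ?_
    rw [braidGen_tmul, evalAct_act M.ρ p.β N.ρ]
    congr 3
    exact (q.α.apply_symm_apply _).symm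
  have hR := tensorAct_apply (p * q * p⁻¹) p (ModData.conj p q N) M h
    (braidGen M.ρ (p.β.symm : H →ₗ[k] H) N.δ (m ⊗ₜ n))
  refine hL.trans (Eq.trans ?_ hR.symm)
  rw [← map_sw, ← hN.equiv (p.twist q) h n, map_sw]
  refine sw_congr fun a b => ?_
  rw [evalAct_op, AutPair.conj_twist]
  -- The tensor product acts on the conjugate through `α`, which cancels the `α⁻¹` in `γ⁻¹βγα⁻¹`.
  have : p.actTwist q (p.α a) = p.twist q a :=
    congrArg (p.twist q) (p.α.symm_apply_apply a)
  rw [← this]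
  rfl

theorem opMul_twist_left (ρ : H →ₐ[k] Module.End k V) (w : W) (a : H) (t : V ⊗[k] H) :
    opMul k W V H ((w ⊗ₜ a) ⊗ₜ t) = opMul k W V H ((w ⊗ₜ 1) ⊗ₜ op ρ 1 1 a t) := by
  induction t with
  | zero => simp
  | add t t' ht ht' => simp only [map_add, TensorProduct.tmul_add, ht, ht']
  | tmul v x => simp

/-- Braiding `m₍₀₎ ⊗ n₍₀₎` applies the coaction of `n` twice; coassociativity replaces this by a
comultiplication of `n₍₁₎`, exposing the left side of a crossing relation for `M`. -/
theorem braidGen_opMul {δ : W →ₗ[k] W ⊗[k] H}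
    (hδ : (Coalgebra.comul (R := k) (A := H)).lTensor W ∘ₗ δ =
      (TensorProduct.assoc k W H H).toLinearMap ∘ₗ δ.rTensor H ∘ₗ δ) (s : V ⊗[k] H) (w : W) :
    (braidGen ρ φ δ).rTensor H (opMul k V W H (s ⊗ₜ δ w)) =
      sweedler (δ w) (fun w' x => sw k x (fun x₁ x₂ =>
        opMul k W V H ((w' ⊗ₜ 1) ⊗ₜ op ρ (φ x₁) x₂ 1 s))) := by
  induction s with
  | zero => simp [sw, sweedler]
  | add s s' hs hs' =>
    simp only [map_add, TensorProduct.add_tmul, TensorProduct.tmul_add, hs, hs', sw_add_fun,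
      sweedler_add_fun]
  | tmul v a =>
    rw [← sweedler_coassoc hδ (f := fun w' x₁ x₂ =>
      opMul k W V H ((w' ⊗ₜ 1) ⊗ₜ op ρ (φ x₁) x₂ 1 (v ⊗ₜ a)))]
    · refine (apply_eq_sweedler ((braidGen ρ φ δ).rTensor H ∘ₗ opMul k V W H ∘ₗ
        TensorProduct.mk k _ _ (v ⊗ₜ a)) (δ w)).trans (sweedler_congr fun w' x => ?_)
      simp only [LinearMap.comp_apply, TensorProduct.mk_apply, opMul_tmul,
        LinearMap.rTensor_tmul, braidGen_tmul, evalAct_eq_sweedler]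
      refine (map_sweedler ((TensorProduct.mk k (W ⊗[k] V) H).flip (x * a)) _ _).trans
        (sweedler_congr fun w'' y => ?_)
      simp
    · refine ⟨?_, ?_, fun a => ⟨?_, ?_, ?_, ?_⟩⟩ <;> intros <;>
        simp [TensorProduct.add_tmul, TensorProduct.tmul_add, ← TensorProduct.smul_tmul', add_mul]

/-- The crossing relation of `M` at `β⁻¹(n₍₁₎)`: its left factor is then `ββ⁻¹ = id`, its right
factor `αβ⁻¹`, which is precisely the twist in the coaction of the conjugate of `N`. -/
theorem braidGen_colinear {p : AutPair k H} {M N : ModData k H} (hM : Crossed p M.ρ M.δ)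
    (hδ : (Coalgebra.comul (R := k) (A := H)).lTensor N.V ∘ₗ N.δ =
      (TensorProduct.assoc k N.V H H).toLinearMap ∘ₗ N.δ.rTensor H ∘ₗ N.δ)
    (t : M.V ⊗[k] N.V) :
    (braidGen M.ρ (p.β.symm : H →ₗ[k] H) N.δ).rTensor H (tensorCoact M N t) =
      (opMul k N.V M.V H ∘ₗ TensorProduct.map (conjCoact p N) M.δ)
        (braidGen M.ρ (p.β.symm : H →ₗ[k] H) N.δ t) := by
  induction t with
  | zero => simp
  | add t t' ht ht' => simp only [map_add, ht, ht']
  | tmul m n =>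
    rw [tensorCoact_tmul, braidGen_opMul _ _ hδ, braidGen_tmul, evalAct_eq_sweedler, map_sweedler]
    have hR : ∀ (n' : N.V) (x : H), (opMul k N.V M.V H ∘ₗ
        TensorProduct.map (conjCoact p N) M.δ) (n' ⊗ₜ M.ρ ((p.β.symm : H →ₗ[k] H) x) m) =
        sweedler (N.δ n') (fun n'' y => opMul k N.V M.V H ((n'' ⊗ₜ 1) ⊗ₜ
          op M.ρ 1 1 (p.α (p.β.symm y)) (M.δ (M.ρ (p.β.symm x) m)))) := fun n' x => by
      refine (apply_eq_sweedler (opMul k N.V M.V H ∘ₗ (TensorProduct.mk k _ _).flip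
        (M.δ (M.ρ (p.β.symm x) m)) ∘ₗ coactTwistMap p N.V) (N.δ n')).trans
        (sweedler_congr fun n'' y => ?_)
      exact opMul_twist_left M.ρ n'' _ _
    simp only [hR]
    rw [sweedler_coassoc hδ (f := fun n' x₁ x₂ => opMul k N.V M.V H ((n' ⊗ₜ 1) ⊗ₜ
          op M.ρ 1 1 (p.α (p.β.symm x₁)) (M.δ (M.ρ (p.β.symm x₂) m))))]
    · refine sweedler_congr fun n' x => ?_
      have := congrArg (opMul k N.V M.V H ∘ₗ TensorProduct.mk k _ _ (n' ⊗ₜ[k] (1 : H)))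
        (hM.equiv p.β.symm x m)
      rw [map_sw, map_sw] at this
      refine Eq.trans (sw_congr fun x₁ x₂ => ?_) this
      rw [BialgEquiv.apply_symm_apply]
      rfl
    · refine ⟨?_, ?_, fun a => ⟨?_, ?_, ?_, ?_⟩⟩ <;> intros <;>
        simp [TensorProduct.add_tmul, TensorProduct.tmul_add, ← TensorProduct.smul_tmul',
          op_add₃, op_smul₃]

theorem isYDHom_braidMap {p q : AutPair k H} {M N : ModData k H} (hM : Crossed p M.ρ M.δ)
    (hN : Crossed q N.ρ N.δ)
    (hδ : (Coalgebra.comul (R := k) (A := H)).lTensor N.V ∘ₗ N.δ =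
      (TensorProduct.assoc k N.V H H).toLinearMap ∘ₗ N.δ.rTensor H ∘ₗ N.δ) :
    IsYDHom (ModData.tensor p q M N) (ModData.tensor (p * q * p⁻¹) p (ModData.conj p q N) M)
      (braidGen M.ρ (p.β.symm : H →ₗ[k] H) N.δ) :=
  ⟨fun h t => braidGen_linear hN h t, fun t => braidGen_colinear hM hδ t⟩

/-- Coassociativity brings the two actions together as `φ(w₁) ψ(w₂)`, which collapses by hypothesis.
With `(φ, φS)` and `(φS, φ)` it yields both one-sided inverses of the braiding. -/
theorem braidGen_comm_braidGen {φ ψ : H →ₗ[k] H} {δ : W →ₗ[k] W ⊗[k] H}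
    (hδ : (Coalgebra.comul (R := k) (A := H)).lTensor W ∘ₗ δ =
      (TensorProduct.assoc k W H H).toLinearMap ∘ₗ δ.rTensor H ∘ₗ δ)
    (hε : (TensorProduct.rid k W).toLinearMap ∘ₗ
      (Coalgebra.counit (R := k) (A := H)).lTensor W ∘ₗ δ = LinearMap.id)
    (h : ∀ x, sw k x (fun a b => φ a * ψ b) = Coalgebra.counit (R := k) x • 1) (v : V) (w : W) :
    braidGen ρ φ δ (TensorProduct.comm k W V (braidGen ρ ψ δ (v ⊗ₜ w))) = w ⊗ₜ v := by
  have h1 : braidGen ρ φ δ (TensorProduct.comm k W V (braidGen ρ ψ δ (v ⊗ₜ w))) =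
      sweedler (δ w) (fun w' x => sweedler (δ w') (fun w'' y => w'' ⊗ₜ ρ (φ y * ψ x) v)) := by
    refine (apply_eq_sweedler (braidGen ρ φ δ ∘ₗ (TensorProduct.comm k W V).toLinearMap ∘ₗ
      evalAct ρ ψ W v) (δ w)).trans (sweedler_congr fun w' x => ?_)
    simp only [LinearMap.comp_apply, evalAct_tmul, LinearEquiv.coe_coe, TensorProduct.comm_tmul,
      braidGen_tmul, map_mul, Module.End.mul_apply]
    exact evalAct_eq_sweedler ..
  rw [h1, sweedler_coassoc hδ (f := fun w' x₁ x₂ => w' ⊗ₜ[k] ρ (φ x₁ * ψ x₂) v)]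
  · have h2 : ∀ (w' : W) (x : H), sw k x (fun x₁ x₂ => w' ⊗ₜ[k] ρ (φ x₁ * ψ x₂) v) =
        Coalgebra.counit (R := k) x • (TensorProduct.mk k W V).flip v w' := fun w' x => by
      refine (map_sw (TensorProduct.mk k W V w' ∘ₗ ρ.toLinearMap.flip v) x _).symm.trans ?_
      rw [h]
      simp
    simp only [h2]
    exact sweedler_counit hε _ w
  · refine ⟨?_, ?_, fun a => ⟨?_, ?_, ?_, ?_⟩⟩ <;> intros <;>
      simp [TensorProduct.add_tmul, TensorProduct.tmul_add, ← TensorProduct.smul_tmul',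
        add_mul, mul_add]

/-- The braiding as a linear equivalence; its inverse is `w ⊗ v ↦ φ(S(w₍₁₎)) · v ⊗ w₍₀₎`. -/
def braidEquiv (φ : H ≃ₐc[k] H) {δ : W →ₗ[k] W ⊗[k] H}
    (hδ : (Coalgebra.comul (R := k) (A := H)).lTensor W ∘ₗ δ =
      (TensorProduct.assoc k W H H).toLinearMap ∘ₗ δ.rTensor H ∘ₗ δ)
    (hε : (TensorProduct.rid k W).toLinearMap ∘ₗ
      (Coalgebra.counit (R := k) (A := H)).lTensor W ∘ₗ δ = LinearMap.id) :
    V ⊗[k] W ≃ₗ[k] W ⊗[k] V :=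
  LinearEquiv.ofLinearMap (braidGen ρ (φ : H →ₗ[k] H) δ)
    ((TensorProduct.comm k W V).toLinearMap ∘ₗ
      braidGen ρ ((φ : H →ₗ[k] H) ∘ₗ HopfAlgebra.antipode k) δ ∘ₗ
      (TensorProduct.comm k W V).toLinearMap)
    (TensorProduct.ext' fun w v => braidGen_comm_braidGen ρ hδ hε (fun x => by
      have := congrArg (φ : H →ₗ[k] H) (sw_mul_antipode (k := k) x)
      rw [map_sw] at this
      simpa using this) v w)
    (TensorProduct.ext' fun v w => congrArg (TensorProduct.comm k W V)
      (braidGen_comm_braidGen ρ hδ hε (fun x => by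
        have := congrArg (φ : H →ₗ[k] H) (sw_antipode_mul (k := k) x)
        rw [map_sw] at this
        simpa using this) v w))

theorem braidGen_natural {V' W' : Type*} [AddCommGroup V'] [Module k V'] [AddCommGroup W']
    [Module k W'] {ρ' : H →ₐ[k] Module.End k V'} {δ : W →ₗ[k] W ⊗[k] H}
    {δ' : W' →ₗ[k] W' ⊗[k] H} {f : V →ₗ[k] V'} {g : W →ₗ[k] W'}
    (hf : ∀ h v, f (ρ h v) = ρ' h (f v)) (hg : ∀ w, g.rTensor H (δ w) = δ' (g w)) :
    braidGen ρ' φ δ' ∘ₗ TensorProduct.map f g =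
      TensorProduct.map g f ∘ₗ braidGen ρ φ δ := by
  refine TensorProduct.ext' fun v w => ?_
  simp only [LinearMap.comp_apply, TensorProduct.map_tmul, braidGen_tmul, ← hg]
  generalize δ w = t
  induction t with
  | zero => simp
  | add t t' ht ht' => simp only [map_add, ht, ht']
  | tmul w x => simp [hf]

/-- Passing `W` and then `U` acts by `φ(u₍₁₎) φ(w₍₁₎) = φ(u₍₁₎ w₍₁₎)`, which is why the coaction of
a tensor product multiplies in reverse order. -/
theorem braidGen_tensor_right (φ : H ≃ₐc[k] H) (δ : W →ₗ[k] W ⊗[k] H) (δ' : U →ₗ[k] U ⊗[k] H) :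
    braidGen ρ (φ : H →ₗ[k] H) (opMul k W U H ∘ₗ TensorProduct.map δ δ') =
      (TensorProduct.assoc k W U V).symm.toLinearMap ∘ₗ
        (braidGen ρ (φ : H →ₗ[k] H) δ').lTensor W ∘ₗ
        (TensorProduct.assoc k W V U).toLinearMap ∘ₗ
        (braidGen ρ (φ : H →ₗ[k] H) δ).rTensor U ∘ₗ
        (TensorProduct.assoc k V W U).symm.toLinearMap := by
  refine TensorProduct.ext' fun v t => ?_
  induction t with
  | zero => simp
  | add t t' ht ht' => simp only [TensorProduct.tmul_add, map_add, ht, ht']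
  | tmul w u =>
    simp only [LinearMap.comp_apply, LinearEquiv.coe_coe, TensorProduct.assoc_symm_tmul,
      LinearMap.rTensor_tmul, braidGen_tmul, TensorProduct.map_tmul]
    generalize δ w = s
    induction s with
    | zero => simp
    | add s s' hs hs' => simp only [TensorProduct.add_tmul, map_add, hs, hs']
    | tmul w' x =>
      simp only [evalAct_tmul, TensorProduct.assoc_tmul, LinearMap.lTensor_tmul, braidGen_tmul]
      generalize δ' u = t
      induction t with
      | zero => simp
      | add t t' ht ht' => simp only [TensorProduct.tmul_add, map_add, ht, ht']
      | tmul u' y => simp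

/-- The inverse of `δγ⁻¹βγ`, followed by the automorphisms of the tensor action, is `β⁻¹γδ⁻¹` on `M`
and `δ⁻¹` on `N`. The extra `γδ⁻¹` is the coaction twist of conjugation by `q = (γ, δ)`;
coassociativity does the rest. -/
theorem braidGen_tensor_left (p q : AutPair k H) (M N : ModData k H) {δ : W →ₗ[k] W ⊗[k] H}
    (hδ : (Coalgebra.comul (R := k) (A := H)).lTensor W ∘ₗ δ =
      (TensorProduct.assoc k W H H).toLinearMap ∘ₗ δ.rTensor H ∘ₗ δ) :
    braidGen (tensorAct p q M N) ((p * q).β.symm : H →ₗ[k] H) δ =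
      (TensorProduct.assoc k W M.V N.V).toLinearMap ∘ₗ
        (braidGen M.ρ (p.β.symm : H →ₗ[k] H) (coactTwistMap q W ∘ₗ δ)).rTensor N.V ∘ₗ
        (TensorProduct.assoc k M.V W N.V).symm.toLinearMap ∘ₗ
        (braidGen N.ρ (q.β.symm : H →ₗ[k] H) δ).lTensor M.V ∘ₗ
        (TensorProduct.assoc k M.V N.V W).toLinearMap := by
  refine TensorProduct.ext_threefold fun m n w => ?_
  have hR : ((TensorProduct.assoc k W M.V N.V).toLinearMap ∘ₗ
        (braidGen M.ρ (p.β.symm : H →ₗ[k] H) (coactTwistMap q W ∘ₗ δ)).rTensor N.V ∘ₗ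
        (TensorProduct.assoc k M.V W N.V).symm.toLinearMap ∘ₗ
        (braidGen N.ρ (q.β.symm : H →ₗ[k] H) δ).lTensor M.V ∘ₗ
        (TensorProduct.assoc k M.V N.V W).toLinearMap) ((m ⊗ₜ n) ⊗ₜ w) =
      sweedler (δ w) (fun w' x => sweedler (δ w') (fun w'' y =>
        w'' ⊗ₜ (M.ρ (p.β.symm (q.coactTwist y)) m ⊗ₜ N.ρ (q.β.symm x) n))) := by
    refine (apply_eq_sweedler ((TensorProduct.assoc k W M.V N.V).toLinearMap ∘ₗ
        (braidGen M.ρ (p.β.symm : H →ₗ[k] H) (coactTwistMap q W ∘ₗ δ)).rTensor N.V ∘ₗ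
        (TensorProduct.assoc k M.V W N.V).symm.toLinearMap ∘ₗ TensorProduct.mk k _ _ m ∘ₗ
        evalAct N.ρ (q.β.symm : H →ₗ[k] H) W n) (δ w)).trans (sweedler_congr fun w' x => ?_)
    simp only [LinearMap.comp_apply, evalAct_tmul, TensorProduct.mk_apply, LinearEquiv.coe_coe,
      TensorProduct.assoc_symm_tmul, LinearMap.rTensor_tmul, braidGen_tmul]
    exact apply_eq_sweedler ((TensorProduct.assoc k W M.V N.V).toLinearMap ∘ₗ
      (TensorProduct.mk k _ _).flip (N.ρ (q.β.symm x) n) ∘ₗ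
      evalAct M.ρ (p.β.symm : H →ₗ[k] H) W m ∘ₗ coactTwistMap q W) (δ w')
  rw [hR, sweedler_coassoc hδ (f := fun w' x₁ x₂ =>
    w' ⊗ₜ[k] (M.ρ (p.β.symm (q.coactTwist x₁)) m ⊗ₜ[k] N.ρ (q.β.symm x₂) n))]
  · rw [braidGen_tmul, evalAct_eq_sweedler]
    refine sweedler_congr fun w' x => ?_
    have h1 : tensorAct p q M N ((p * q).β.symm x) (m ⊗ₜ n) = sw k x (fun x₁ x₂ =>
        M.ρ (p.β.symm (q.coactTwist x₁)) m ⊗ₜ[k] N.ρ (q.β.symm x₂) n) := by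
      rw [tensorAct_tmul, sw_equiv]
      · refine sw_congr fun x₁ x₂ => ?_
        simp [AutPair.mul_β_symm_apply, AutPair.twist_apply, AutPair.coactTwist_apply]
      · constructor <;> intros <;> simp [TensorProduct.add_tmul, TensorProduct.tmul_add,
          TensorProduct.smul_tmul']
    exact (congrArg (w' ⊗ₜ[k] ·) h1).trans (map_sw (TensorProduct.mk k W (M.V ⊗[k] N.V) w') x _)
  · refine ⟨?_, ?_, fun a => ⟨?_, ?_, ?_, ?_⟩⟩ <;> intros <;>
      simp [TensorProduct.add_tmul, TensorProduct.tmul_add, ← TensorProduct.smul_tmul']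

/-- By `AutPair.conj_β_apply`, the twists of the action and of the coaction cancel against those
hidden in the inverse of the `β`-component of `p * q * p⁻¹`. -/
theorem braidGen_conj (p q : AutPair k H) (M : ModData k H) (δ : W →ₗ[k] W ⊗[k] H) :
    braidGen (conjAct p q M) ((p * q * p⁻¹).β.symm : H →ₗ[k] H) (coactTwistMap p W ∘ₗ δ) =
      braidGen M.ρ (q.β.symm : H →ₗ[k] H) δ := by
  refine TensorProduct.ext' fun m w => ?_
  rw [braidGen_tmul, braidGen_tmul, LinearMap.comp_apply]
  refine LinearMap.congr_fun (f := evalAct (conjAct p q M)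
    ((p * q * p⁻¹).β.symm : H →ₗ[k] H) W m ∘ₗ coactTwistMap p W)
    (g := evalAct M.ρ (q.β.symm : H →ₗ[k] H) W m) (TensorProduct.ext' fun w x => ?_) (δ w)
  have h : p.actTwist q ((p * q * p⁻¹).β.symm (p.coactTwist x)) = q.β.symm x := by
    refine EquivLike.injective q.β (EquivLike.injective p.coactTwist ?_)
    rw [← AutPair.conj_β_apply, BialgEquiv.apply_symm_apply, BialgEquiv.apply_symm_apply]
  have h' : conjAct p q M ((p * q * p⁻¹).β.symm (p.coactTwist x)) = M.ρ (q.β.symm x) :=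
    congrArg M.ρ h
  rw [LinearMap.comp_apply, coactTwistMap_tmul, evalAct_tmul, evalAct_tmul]
  exact congrArg (w ⊗ₜ[k] ·) (LinearMap.congr_fun h' m)

end Braid

/-! ### The braided T-category -/

section Braiding

variable {k H : Type u} [Field k] [Ring H] [HopfAlgebra k H]

/-- The linear map `v ⊗ w ↦ w₍₀₎ ⊗ φ(w₍₁₎) · v`, as a morphism of vector spaces. -/
def braidHom (A B : ModuleCat.{u} k) (ρ : H →ₐ[k] Module.End k A) (φ : H ≃ₐc[k] H)
    (δ : B →ₗ[k] B ⊗[k] H) : A ⊗ B ⟶ B ⊗ A :=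
  ModuleCat.ofHom (braidGen ρ (φ : H →ₗ[k] H) δ)

variable [BijectiveAntipode k H]

/-- The braiding isomorphisms. -/
def braidIso (X Y : Σ p : AutPair k H, YDMod k H p) :
    X ⊗ Y ≅ (tCategory k H).act X Y ⊗ X :=
  mkIso (show X.1 * Y.1 = X.1 * Y.1 * X.1⁻¹ * X.1 by group)
    (braidEquiv X.2.ρ X.1.β.symm Y.2.coassoc Y.2.counit)
    (isYDHom_braidMap X.2.crossed Y.2.crossed Y.2.coassoc)

theorem lies_braidIso (X Y : Σ p : AutPair k H, YDMod k H p) :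
    Lies (braidIso X Y).hom
      (braidHom ((forget k H).obj X) ((forget k H).obj Y) X.2.ρ X.1.β.symm Y.2.δ) :=
  lies_mkHom _ _ _

theorem forget_obj_act (X Y : Σ p : AutPair k H, YDMod k H p) :
    (forget k H).obj ((tCategory k H).act X Y) = (forget k H).obj Y := rfl

theorem lies_conj_map (p : AutPair k H) {X Y : Σ q : AutPair k H, YDMod k H q} {f : X ⟶ Y}
    {A B : ModuleCat.{u} k} {a : A ⟶ B} (hf : Lies f a) :
    Lies (((tCategory k H).conj p).map f) a :=
  lies_conjFunctor_map p hf

theorem braidIso_naturality {X X' Y Y' : Σ p : AutPair k H, YDMod k H p} (f : X ⟶ X')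
    (f' : Y ⟶ Y') :
    (f ⊗ₘ f') ≫ (braidIso X' Y').hom =
      (braidIso X Y).hom ≫ ((((tCategory k H).conj X.1).map f' ≫
        eqToHom ((tCategory k H).act_congr (TCat.deg_eq_of_hom f) Y')) ⊗ₘ f) := by
  have h₁ := ((lies_map f).tensorHom (lies_map f')).comp (lies_braidIso X' Y')
  have h₂ := (lies_braidIso X Y).comp (((lies_conj_map X.1 (lies_map f')).comp
    (lies_eqToHom ((tCategory k H).act_congr (TCat.deg_eq_of_hom f) Y')
      (forget_obj_act X Y'))).tensorHom (lies_map f))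
  rw [Category.comp_id] at h₂
  have h := braidGen_natural X.2.ρ (X.1.β.symm : H →ₗ[k] H) (f := lin f) (g := lin f')
    (isYDHom_lin f).linear (isYDHom_lin f').colinear
  have h₃ : ((forget k H).map f ⊗ₘ (forget k H).map f') ≫
      braidHom ((forget k H).obj X') ((forget k H).obj Y') X'.2.ρ X'.1.β.symm Y'.2.δ =
      braidHom ((forget k H).obj X) ((forget k H).obj Y) X.2.ρ X.1.β.symm Y.2.δ ≫
        ((forget k H).map f' ⊗ₘ (forget k H).map f) :=
    -- The braidings use `β⁻¹` from the degrees of `X'` and of `X`, equal because `f` joins these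
    -- objects.
    (congrArg (fun p : AutPair k H => ((forget k H).map f ⊗ₘ (forget k H).map f') ≫
      braidHom ((forget k H).obj X') ((forget k H).obj Y') X'.2.ρ p.β.symm Y'.2.δ)
        (TCat.deg_eq_of_hom f).symm).trans (congrArg ModuleCat.ofHom h)
  rw [h₃] at h₁
  exact h₁.unique h₂

theorem braidIso_hexagon_left (X Y Z : Σ p : AutPair k H, YDMod k H p) :
    (braidIso (X ⊗ Y) Z).hom =
      (α_ X Y Z).hom ≫ (X ◁ (braidIso Y Z).hom) ≫
      (α_ X ((tCategory k H).act Y Z) Y).inv ≫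
      ((braidIso X ((tCategory k H).act Y Z)).hom ▷ Y) ≫
      (α_ ((tCategory k H).act X ((tCategory k H).act Y Z)) X Y).hom ≫
      (eqToHom ((tCategory k H).act_act X Y Z) ▷ (X ⊗ Y)) := by
  have h₁ : Lies (braidIso (X ⊗ Y) Z).hom
      (braidHom ((forget k H).obj X ⊗ (forget k H).obj Y) ((forget k H).obj Z)
        (tensorAct X.1 Y.1 X.2.toModData Y.2.toModData) (X.1 * Y.1).β.symm Z.2.δ) :=
    lies_braidIso (X ⊗ Y) Z
  have h₂ : Lies (braidIso X ((tCategory k H).act Y Z)).hom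
      (braidHom ((forget k H).obj X) ((forget k H).obj Z) X.2.ρ X.1.β.symm
        (conjCoact Y.1 Z.2.toModData)) :=
    lies_braidIso X ((tCategory k H).act Y Z)
  have h₃ := (lies_associator_hom (X := X) (Y := Y) (Z := Z) rfl rfl rfl).comp
    (((lies_braidIso Y Z).whiskerLeft (Z := X) rfl).comp
    ((lies_associator_inv (X := X) (Y := (tCategory k H).act Y Z) (Z := Y)
      rfl (forget_obj_act Y Z) rfl).comp
    ((h₂.whiskerRight (Z := Y) rfl).comp
    ((lies_associator_hom (X := (tCategory k H).act X ((tCategory k H).act Y Z)) (Y := X)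
      (Z := Y) ((forget_obj_act X _).trans (forget_obj_act Y Z)) rfl rfl).comp
    ((lies_eqToHom ((tCategory k H).act_act X Y Z) ((forget_obj_act X _).trans
      (forget_obj_act Y Z))).whiskerRight (forget_obj_tensor X Y))))))
  rw [id_whiskerRight, Category.comp_id] at h₃
  have h := braidGen_tensor_left X.1 Y.1 X.2.toModData Y.2.toModData Z.2.coassoc
  have h₄ : braidHom ((forget k H).obj X ⊗ (forget k H).obj Y) ((forget k H).obj Z)
        (tensorAct X.1 Y.1 X.2.toModData Y.2.toModData) (X.1 * Y.1).β.symm Z.2.δ =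
      (α_ ((forget k H).obj X) ((forget k H).obj Y) ((forget k H).obj Z)).hom ≫
      ((forget k H).obj X ◁ braidHom ((forget k H).obj Y) ((forget k H).obj Z) Y.2.ρ
        Y.1.β.symm Z.2.δ) ≫
      (α_ ((forget k H).obj X) ((forget k H).obj Z) ((forget k H).obj Y)).inv ≫
      (braidHom ((forget k H).obj X) ((forget k H).obj Z) X.2.ρ X.1.β.symm
        (conjCoact Y.1 Z.2.toModData) ▷ (forget k H).obj Y) ≫
      (α_ ((forget k H).obj Z) ((forget k H).obj X) ((forget k H).obj Y)).hom :=
    congrArg ModuleCat.ofHom h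
  rw [h₄] at h₁
  exact h₁.unique h₃

theorem braidIso_hexagon_right (X Y Z : Σ p : AutPair k H, YDMod k H p) :
    (braidIso X (Y ⊗ Z)).hom =
      (α_ X Y Z).inv ≫ ((braidIso X Y).hom ▷ Z) ≫
      (α_ ((tCategory k H).act X Y) X Z).hom ≫
      ((tCategory k H).act X Y ◁ (braidIso X Z).hom) ≫
      (α_ ((tCategory k H).act X Y) ((tCategory k H).act X Z) X).inv ≫
      (eqToHom ((tCategory k H).act_tensor X Y Z).symm ▷ X) := by
  have h₁ : Lies (braidIso X (Y ⊗ Z)).hom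
      (braidHom ((forget k H).obj X) ((forget k H).obj Y ⊗ (forget k H).obj Z)
        X.2.ρ X.1.β.symm (opMul k Y.2.V Z.2.V H ∘ₗ TensorProduct.map Y.2.δ Z.2.δ)) :=
    lies_braidIso X (Y ⊗ Z)
  have h₃ := (lies_associator_inv (X := X) (Y := Y) (Z := Z) rfl rfl rfl).comp
    (((lies_braidIso X Y).whiskerRight (Z := Z) rfl).comp
    ((lies_associator_hom (X := (tCategory k H).act X Y) (Y := X) (Z := Z)
      (forget_obj_act X Y) rfl rfl).comp
    (((lies_braidIso X Z).whiskerLeft (forget_obj_act X Y)).comp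
    ((lies_associator_inv (X := (tCategory k H).act X Y) (Y := (tCategory k H).act X Z)
      (Z := X) (forget_obj_act X Y) (forget_obj_act X Z) rfl).comp
    ((lies_eqToHom ((tCategory k H).act_tensor X Y Z).symm
      (forget_obj_tensor ((tCategory k H).act X Y) ((tCategory k H).act X Z))).whiskerRight
      (Z := X) rfl)))))
  have h₄ : braidHom ((forget k H).obj X) ((forget k H).obj Y ⊗ (forget k H).obj Z)
        X.2.ρ X.1.β.symm (opMul k Y.2.V Z.2.V H ∘ₗ TensorProduct.map Y.2.δ Z.2.δ) =
      (α_ ((forget k H).obj X) ((forget k H).obj Y) ((forget k H).obj Z)).inv ≫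
      (braidHom ((forget k H).obj X) ((forget k H).obj Y) X.2.ρ X.1.β.symm Y.2.δ ▷
        (forget k H).obj Z) ≫
      (α_ ((forget k H).obj Y) ((forget k H).obj X) ((forget k H).obj Z)).hom ≫
      ((forget k H).obj Y ◁ braidHom ((forget k H).obj X) ((forget k H).obj Z) X.2.ρ
        X.1.β.symm Z.2.δ) ≫
      (α_ ((forget k H).obj Y) ((forget k H).obj Z) ((forget k H).obj X)).inv :=
    congrArg ModuleCat.ofHom (braidGen_tensor_right X.2.ρ X.1.β.symm Y.2.δ Z.2.δ)
  rw [h₄] at h₁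
  refine h₁.unique ?_
  simpa only [forget_obj_act, id_whiskerRight, Category.comp_id] using h₃

theorem conj_braidIso (p : AutPair k H) (X Y : Σ q : AutPair k H, YDMod k H q) :
    ((tCategory k H).conj p).map (braidIso X Y).hom =
      eqToHom (((tCategory k H).conj_strict p).obj_tensor X Y) ≫
      (braidIso (((tCategory k H).conj p).obj X) (((tCategory k H).conj p).obj Y)).hom ≫
      eqToHom ((((tCategory k H).conj_strict p).obj_tensor ((tCategory k H).act X Y) X).trans
        (congrArg (fun Z => Z ⊗ ((tCategory k H).conj p).obj X)
          ((tCategory k H).conj_act p X Y))).symm := by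
  have h₁ := lies_conj_map p (lies_braidIso X Y)
  have h₂ : Lies (braidIso (((tCategory k H).conj p).obj X) (((tCategory k H).conj p).obj Y)).hom
      (braidHom ((forget k H).obj X) ((forget k H).obj Y) (conjAct p X.1 X.2.toModData)
        (p * X.1 * p⁻¹).β.symm (conjCoact p Y.2.toModData)) :=
    lies_braidIso (((tCategory k H).conj p).obj X) (((tCategory k H).conj p).obj Y)
  have h₃ := (lies_eqToHom (((tCategory k H).conj_strict p).obj_tensor X Y)
    ((forget_obj_conjFunctor p (X ⊗ Y)).trans (forget_obj_tensor X Y))).comp (h₂.comp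
    (lies_eqToHom ((((tCategory k H).conj_strict p).obj_tensor
      ((tCategory k H).act X Y) X).trans
        (congrArg (fun Z => Z ⊗ ((tCategory k H).conj p).obj X)
          ((tCategory k H).conj_act p X Y))).symm
      ((forget_obj_tensor _ _).trans (congrArg₂ (· ⊗ ·)
        ((forget_obj_act _ _).trans (forget_obj_conjFunctor p Y))
        (forget_obj_conjFunctor p X)))))
  rw [Category.id_comp, Category.comp_id] at h₃
  have h₄ : braidHom ((forget k H).obj X) ((forget k H).obj Y) (conjAct p X.1 X.2.toModData)
        (p * X.1 * p⁻¹).β.symm (conjCoact p Y.2.toModData) =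
      braidHom ((forget k H).obj X) ((forget k H).obj Y) X.2.ρ X.1.β.symm Y.2.δ :=
    congrArg ModuleCat.ofHom (braidGen_conj p X.1 X.2.toModData Y.2.δ)
  rw [h₄] at h₃
  exact h₁.unique h₃

/-- The braided T-category `YD(H)`. -/
def braidedTCategory (k H : Type u) [Field k] [Ring H] [HopfAlgebra k H]
    [BijectiveAntipode k H] : TCat.BraidedTCategory (AutPair k H) (YDMod k H) where
  toTCategory := tCategory k H
  c := braidIso
  naturality := braidIso_naturality
  hexagon_left := braidIso_hexagon_left
  hexagon_right := braidIso_hexagon_right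
  conj_c := conj_braidIso

end Braiding

end YD

end

theorem mainTheorem1 (k H : Type u) [Field k] [Ring H] [HopfAlgebra k H]
    [YD.BijectiveAntipode k H] :
    ∃ (_ : MonoidalCategory (Σ g : YD.AutPair k H, YD.YDMod k H g))
      (T : TCat.BraidedTCategory (YD.AutPair k H) (YD.YDMod k H)),
      -- unit object, tensor product of objects
      (𝟙_ (Σ g : YD.AutPair k H, YD.YDMod k H g)).2.toModData = YD.ModData.unit k H ∧
      (∀ X Y : Σ g : YD.AutPair k H, YD.YDMod k H g,
        (X ⊗ Y).2.toModData = YD.ModData.tensor X.1 Y.1 X.2.toModData Y.2.toModData) ∧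
      -- tensor product of morphisms, associativity and unit constraints are those of vector spaces
      TCat.IsStrictTensor (YD.forget k H) ∧
      -- conjugation, on objects and on morphisms
      (∀ (p : YD.AutPair k H) (X : Σ g : YD.AutPair k H, YD.YDMod k H g),
        ((T.conj p).obj X).2.toModData = YD.ModData.conj p X.1 X.2.toModData) ∧
      (∀ p : YD.AutPair k H, T.conj p ⋙ YD.forget k H = YD.forget k H) ∧
      -- braiding
      (∀ X Y : Σ g : YD.AutPair k H, YD.YDMod k H g,
        Arrow.mk ((YD.forget k H).map (T.c X Y).hom) =
          Arrow.mk (ModuleCat.ofHom (YD.braidMap X.1 X.2.toModData Y.2.toModData))) :=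
  -- The clauses on objects hold by definition, and `braidMap` unfolds to `braidGen`.
  ⟨YD.monoidal k H, YD.braidedTCategory k H, rfl, fun _ _ => rfl, YD.forget_isStrictTensor k H,
    fun _ _ => rfl, YD.conjFunctor_comp_forget, fun X Y => YD.lies_braidIso X Y⟩
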